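/- Let $d\ge 1$ be an integer, let $\alpha\in(0,2)$, $\beta>0$, $\gamma>0$, and let $s\in\mathbb{R}$ satisfy $\alpha/2<|s|\le 1$. Let $E_{\alpha,\beta}(z)=\sum_{k=0}^{\infty}\frac{z^{k}}{\Gamma(\alpha k+\beta)}$ be the Mittag-Leffler function. Then the function $x\mapsto E_{\alpha,\beta}(e^{i\pi s}|x|^{\gamma})$ on $\mathbb{R}^{d}$ is bounded, and its Fourier transform, in the sense of tempered distributions, is a function in $L^{p}(\mathbb{R}^{d})$ for every $p\in(1,\infty]$ with $\gamma p'>d$, where $p'$ is the conjugate exponent, $\frac1p+\frac1{p'}=1$ (so $p'=1$ for $p=\infty$). In other words, it is in $L^{p}(\mathbb{R}^{d})$ for all \begin{align*} &1<p\le\infty, && \text{if } \gamma>d,\\ &1<p<\infty, && \text{if } \gamma=d,\\ &1<p<\frac{d}{d-\gamma}, && \text{if } \gamma<d. \end{align*} -/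

import Mathlib

open MeasureTheory
open scoped ENNReal FourierTransform SchwartzMap

/-- The two-parameter Mittag-Leffler function
`E_{α,β}(z) = ∑_{k ≥ 0} z ^ k / Γ(α k + β)`; the series converges absolutely for every `z`
when `α, β > 0`. -/
noncomputable def mittagLeffler (α β : ℝ) (z : ℂ) : ℂ :=
  ∑' k : ℕ, z ^ k / (Real.Gamma (α * k + β) : ℂ)

/-- The radial function `x ↦ E_{α,β}(e^{iπs} |x|^γ)` on `ℝ^d` with the Euclidean norm. -/
noncomputable def mittagLefflerRadial (d : ℕ) (α β s γ : ℝ) :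
    EuclideanSpace ℝ (Fin d) → ℂ :=
  fun x => mittagLeffler α β
    (Complex.exp (Complex.I * (Real.pi : ℂ) * (s : ℂ)) * ((‖x‖ ^ γ : ℝ) : ℂ))

/-- `f` is an essentially bounded measurable function on `ℝ^d` (so it defines a tempered
distribution) whose Fourier transform, in the sense of tempered distributions, is (given by)
a function in `L^p(ℝ^d)`, where `1 ≤ p ≤ ∞`. The Fourier transform is normalized by
`𝓕 φ (ξ) = ∫ e^{-2πi⟨x, ξ⟩} φ(x) dx`. -/
def FourierTransformMemLp {d : ℕ} (f : EuclideanSpace ℝ (Fin d) → ℂ) (p : ℝ≥0∞) : Prop :=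
  ∃ (hf : MemLp f ∞ volume) (_ : Fact (1 ≤ p)) (g : Lp ℂ p (volume : Measure (EuclideanSpace ℝ (Fin d)))),
    𝓕 (Lp.toTemperedDistribution (hf.toLp f)) = Lp.toTemperedDistribution g

/-!
# Fourier transform of radial Mittag-Leffler functions

Write `e^{iπs} = e^{iφ}` with `πα/2 < φ < 2π - πα/2`. The function `x ↦ E_{α,β}(e^{iφ} ‖x‖^γ)` is
written as an absolutely convergent superposition of dilates of one Schwartz function, so that its
Fourier transform can be read off and estimated pointwise.

* Hankel's formula for `1 / Γ` (`hankelIntegral_kernel`) gives a contour integral for `E_{α,β}`, and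
  from it the decay `E_{α,β}(r e^{iθ}) = O(1 / r)`, uniform for `θ` near `φ`
  (`norm_mittagLeffler_le`). All contours are taken in the variable `u = log t`, where they
  consist of horizontal and vertical segments and Cauchy's theorem is needed on rectangles only.
* For small `κ > 0` the entire function `H(u) = E_{α,β}(e^{iφ + κu})` decays at the right end of the
  strip `|Im u| ≤ π` and tends to `E_{α,β}(0)` at the left end, both at the rate `e^{-κ|Re u|}`.
  Cauchy's theorem on the strip yields `E_{α,β}(e^{iφ} v^κ) = ∫ D(y) e^y / (e^y + v) dy` with
  `|D(y)| ≤ C e^{-κ|y|}` (`integral_stripJump`, `exists_stieltjes_mittagLeffler`).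
* Take `κ = γ / N` with `N` a large multiple of `4`, put `v = ‖x‖^N` and write the Stieltjes kernel as
  `∫ e^{-σ} exp (-σ e^{-y} v) dσ` over `σ > 0`. This exhibits the radial function as a superposition
  of the dilates `x ↦ f(l x)` of the Schwartz function `f(x) = exp (-‖x‖^N)`, with
  `l = (σ e^{-y})^{1/N}`. Its Fourier transform is the superposition of the functions
  `l^{-d} (𝓕 f)(ξ / l)` (`integral_fourier_mul_superposition`). Since `𝓕 f` is `O(‖ξ‖^{-b})` for every
  `b ≥ 0`, the superposition is `O(‖ξ‖^{-b})` whenever `l^{b-d}` is integrable against the weight, that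
  is for all `b ≥ 0` with `|b - d| < γ` (`exists_fourier_mittagLeffler_norm`).
* For `p < ∞` two exponents `b` on either side of `d / p` give membership in `L^p`; they can
  be taken admissible when `d (1 - 1/p) < γ`. For `p = ∞` the exponent `b = 0` is used.
-/

/-! ### Cauchy's theorem on half-strips and the Hankel contour -/

open Filter Topology Set Complex in
/-- Cauchy's theorem for the rectangle `[a, b] × [c, d]`. -/
lemma rectangle_integral_eq_zero {G : ℂ → ℂ} {a b c d : ℝ}
    (hG : DifferentiableOn ℂ G (uIcc a b ×ℂ uIcc c d)) :
    (∫ x in a..b, G (x + c * I)) - (∫ x in a..b, G (x + d * I))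
      + I * (∫ y in c..d, G (b + y * I)) - I * (∫ y in c..d, G (a + y * I)) = 0 := by
  have h := integral_boundary_rect_eq_zero_of_differentiableOn G (a + c * I) (b + d * I)
    (by simpa using hG)
  simpa using h

open Filter Topology Set Complex in
/-- Cauchy's theorem for the half-strip `[a, ∞) × [c, d]`. -/
lemma halfStrip_integral {G : ℂ → ℂ} {a c d : ℝ} (hcd : c ≤ d) {B : ℝ → ℝ}
    (hG : DifferentiableOn ℂ G (Ici a ×ℂ Icc c d))
    (hc : IntegrableOn (fun x : ℝ => G (x + c * I)) (Ioi a))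
    (hd : IntegrableOn (fun x : ℝ => G (x + d * I)) (Ioi a))
    (hB : Tendsto B atTop (𝓝 0))
    (hGB : ∀ᶠ R in atTop, ∀ y ∈ Icc c d, ‖G ((R : ℝ) + y * I)‖ ≤ B R) :
    (∫ x in Ioi a, G (x + c * I)) - (∫ x in Ioi a, G (x + d * I))
      = I * ∫ y in c..d, G (a + y * I) := by
  have t1 := intervalIntegral_tendsto_integral_Ioi a hc tendsto_id
  have t2 := intervalIntegral_tendsto_integral_Ioi a hd tendsto_id
  have t3 : Tendsto (fun R : ℝ => ∫ y in c..d, G (R + y * I)) atTop (𝓝 0) := by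
    have hb : Tendsto (fun R => B R * |d - c|) atTop (𝓝 0) := by simpa using hB.mul_const |d - c|
    refine squeeze_zero_norm' ?_ hb
    filter_upwards [hGB] with R hR
    refine intervalIntegral.norm_integral_le_of_norm_le_const fun y hy => hR y ?_
    rw [uIoc_of_le hcd] at hy
    exact ⟨hy.1.le, hy.2⟩
  have t4 : Tendsto (fun R : ℝ => (∫ x in a..R, G (x + c * I)) - (∫ x in a..R, G (x + d * I))
      + I * (∫ y in c..d, G (R + y * I))) atTop
      (𝓝 ((∫ x in Ioi a, G (x + c * I)) - (∫ x in Ioi a, G (x + d * I)) + I * 0)) :=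
    (t1.sub t2).add (t3.const_mul I)
  have t5 : Tendsto (fun R : ℝ => (∫ x in a..R, G (x + c * I)) - (∫ x in a..R, G (x + d * I))
      + I * (∫ y in c..d, G (R + y * I))) atTop (𝓝 (I * ∫ y in c..d, G (a + y * I))) := by
    refine tendsto_const_nhds.congr' ?_
    filter_upwards [eventually_ge_atTop a] with R hR
    have := rectangle_integral_eq_zero (G := G) (a := a) (b := R) (c := c) (d := d)
      (hG.mono (by
        rw [uIcc_of_le hR, uIcc_of_le hcd]
        exact inter_subset_inter (preimage_mono Icc_subset_Ici_self) subset_rfl))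
    linear_combination -this
  simpa using tendsto_nhds_unique t4 t5

open Filter Topology Set Complex in
/-- Cauchy's theorem for the half-strip `(-∞, a] × [c, d]`. -/
lemma halfStrip_integral_left {G : ℂ → ℂ} {a c d : ℝ} (hcd : c ≤ d) {B : ℝ → ℝ}
    (hG : DifferentiableOn ℂ G (Iic a ×ℂ Icc c d))
    (hc : IntegrableOn (fun x : ℝ => G (x + c * I)) (Iic a))
    (hd : IntegrableOn (fun x : ℝ => G (x + d * I)) (Iic a))
    (hB : Tendsto B atBot (𝓝 0))
    (hGB : ∀ᶠ R in atBot, ∀ y ∈ Icc c d, ‖G ((R : ℝ) + y * I)‖ ≤ B R) :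
    (∫ x in Iic a, G (x + d * I)) - (∫ x in Iic a, G (x + c * I))
      = I * ∫ y in c..d, G (a + y * I) := by
  have e' : ∀ k : ℝ, IntegrableOn (fun x : ℝ => G (x + k * I)) (Iic a) →
      IntegrableOn (fun x : ℝ => G (-((x : ℂ) + (-k : ℝ) * I))) (Ioi (-a)) := by
    intro k hk
    have := (hk.mono_set Iio_subset_Iic_self).comp_neg
    rw [Set.neg_Iio] at this
    refine this.congr_fun (fun x _ => ?_) measurableSet_Ioi
    push_cast
    ring_nf
  have key := halfStrip_integral (G := fun z => G (-z)) (a := -a) (c := -d) (d := -c)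
    (B := fun R => B (-R)) (neg_le_neg hcd) ?_ ?_ ?_ (hB.comp tendsto_neg_atTop_atBot) ?_
  · have e : ∀ k : ℝ, (∫ x in Ioi (-a), G (-((x : ℂ) + (-k : ℝ) * I)))
        = ∫ x in Iic a, G (x + k * I) := by
      intro k
      have := integral_comp_neg_Ioi (-a) (fun x : ℝ => G (x + k * I))
      rw [neg_neg] at this
      rw [← this]
      refine integral_congr_ae (.of_forall fun x => ?_)
      push_cast
      ring_nf
    rw [e, e] at key
    rw [key, ← intervalIntegral.integral_comp_neg]
    congr 1
    refine intervalIntegral.integral_congr fun y _ => ?_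
    push_cast
    ring_nf
  · intro z hz
    refine (DifferentiableOn.comp (t := Iic a ×ℂ Icc c d) hG (by fun_prop) ?_) z hz
    rintro z ⟨h1, h2, h3⟩
    simp only [mem_preimage, mem_Ici] at h1 h2 h3
    refine ⟨?_, ?_, ?_⟩ <;> simp <;> linarith
  · exact e' d hd
  · exact e' c hc
  · filter_upwards [tendsto_neg_atTop_atBot.eventually hGB] with R hR y hy
    have := hR (-y) ⟨by linarith [hy.2], by linarith [hy.1]⟩
    convert this using 3
    push_cast
    ring

/-- The integrand of Hankel's formula for `1 / Γ(w)` in the logarithmic variable `u = log t`: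
`e^t t^{-w} dt = exp (e^u + (1 - w) u) du`. -/
noncomputable def hankelKernel (w : ℝ) (u : ℂ) : ℂ :=
  Complex.exp (Complex.exp u + (1 - w) * u)

/-- The integral of `G` along the Hankel contour in the logarithmic variable: in from `+∞ - iψ` to
`L - iψ`, up to `L + iψ`, and out to `+∞ + iψ`. -/
noncomputable def hankelIntegral (ψ L : ℝ) (G : ℂ → ℂ) : ℂ :=
  (∫ y in Set.Ioi L, G (y + ψ * Complex.I)) - (∫ y in Set.Ioi L, G (y + (-ψ : ℝ) * Complex.I))
    + Complex.I * ∫ t in (-ψ)..ψ, G (L + t * Complex.I)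

open Filter Topology Set Complex in
/-- The contour integral does not depend on the abscissa of the vertical side. -/
lemma hankelIntegral_congr_left {G : ℂ → ℂ} {ψ L L' : ℝ} (hψ : 0 ≤ ψ) (hL : L ≤ L')
    (hG : DifferentiableOn ℂ G (Icc L L' ×ℂ Icc (-ψ) ψ))
    (h1 : IntegrableOn (fun y : ℝ => G (y + ψ * I)) (Ioi L))
    (h2 : IntegrableOn (fun y : ℝ => G (y + (-ψ : ℝ) * I)) (Ioi L)) :
    hankelIntegral ψ L G = hankelIntegral ψ L' G := by
  have key := rectangle_integral_eq_zero (G := G) (a := L) (b := L') (c := -ψ) (d := ψ)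
    (by rwa [uIcc_of_le hL, uIcc_of_le (by linarith)])
  have hs : ∀ f : ℝ → ℂ, IntegrableOn f (Ioi L) →
      ∫ y in Ioi L, f y = (∫ y in L..L', f y) + ∫ y in Ioi L', f y := by
    intro f hf
    rw [intervalIntegral.integral_of_le hL, ← setIntegral_union (Ioc_disjoint_Ioi le_rfl)
      measurableSet_Ioi (hf.mono_set Ioc_subset_Ioi_self) (hf.mono_set (Ioi_subset_Ioi hL)),
      Ioc_union_Ioi_eq_Ioi hL]
  rw [hankelIntegral, hankelIntegral, hs _ h1, hs _ h2]
  linear_combination -key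

open Filter Topology Set in
lemma tendsto_mul_sub_mul_exp_atBot {c : ℝ} (hc : 0 < c) (m : ℝ) :
    Tendsto (fun y : ℝ => m * y - c * Real.exp y) atTop atBot := by
  have h : Tendsto (fun y : ℝ => y * (m - c * (Real.exp y / y))) atTop atBot := by
    refine tendsto_id.atTop_mul_atBot₀ ?_
    have h0 : Tendsto (fun y : ℝ => Real.exp y / y) atTop atTop := by
      simpa using Real.tendsto_exp_div_pow_atTop 1
    exact tendsto_atBot_add_const_left _ m (tendsto_neg_atTop_atBot.comp (h0.const_mul_atTop hc))
  refine h.congr' ?_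
  filter_upwards [eventually_gt_atTop 0] with y hy
  field_simp

open Filter Topology Set in
/-- Continuous functions dominated by `exp (m y - c e^y)` are integrable at `+∞`. -/
lemma integrableOn_of_norm_le_exp_sub_exp {f : ℝ → ℂ} {L C c m : ℝ} (hc : 0 < c)
    (hf : ContinuousOn f (Ici L)) (hb : ∀ y ∈ Ici L, ‖f y‖ ≤ C * Real.exp (m * y - c * Real.exp y)) :
    IntegrableOn f (Ioi L) := by
  have hg : IntegrableOn (fun y => C * Real.exp (m * y - c * Real.exp y)) (Ioi L) := by
    refine Integrable.const_mul ?_ C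
    refine integrable_of_isBigO_exp_neg (b := 1) one_pos (by fun_prop) ?_
    refine Asymptotics.IsBigO.of_bound 1 ?_
    filter_upwards [(tendsto_mul_sub_mul_exp_atBot hc (m + 1)).eventually_le_atBot 0] with y hy
    rw [Real.norm_of_nonneg (Real.exp_nonneg _), Real.norm_of_nonneg (Real.exp_nonneg _), one_mul]
    exact Real.exp_le_exp.2 (by linarith)
  refine Integrable.mono' hg
    ((hf.mono Ioi_subset_Ici_self).aestronglyMeasurable measurableSet_Ioi) ?_
  filter_upwards [ae_restrict_mem measurableSet_Ioi] with y hy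
  exact hb y (mem_Ioi.1 hy).le

lemma norm_hankelKernel (w y t : ℝ) :
    ‖hankelKernel w (y + t * Complex.I)‖ = Real.exp (Real.exp y * Real.cos t + (1 - w) * y) := by
  rw [hankelKernel, Complex.norm_exp]
  congr 1
  simp [Complex.exp_re]

lemma differentiable_hankelKernel (w : ℝ) : Differentiable ℂ (hankelKernel w) := by
  unfold hankelKernel; fun_prop

@[fun_prop]
lemma continuous_hankelKernel (w : ℝ) : Continuous (hankelKernel w) :=
  (differentiable_hankelKernel w).continuous

lemma norm_hankelKernel_le {ψ t : ℝ} (ht : Real.cos t ≤ Real.cos ψ) (w y : ℝ) :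
    ‖hankelKernel w (y + t * Complex.I)‖
      ≤ 1 * Real.exp ((1 - w) * y - (-Real.cos ψ) * Real.exp y) := by
  rw [norm_hankelKernel, one_mul]
  refine Real.exp_le_exp.2 ?_
  nlinarith [Real.exp_pos y]

open Set in
lemma integrableOn_hankelKernel {t : ℝ} (ht : Real.cos t < 0) (w L : ℝ) :
    IntegrableOn (fun y : ℝ => hankelKernel w (y + t * Complex.I)) (Ioi L) :=
  integrableOn_of_norm_le_exp_sub_exp (neg_pos.2 ht) (by fun_prop)
    fun y _ => norm_hankelKernel_le le_rfl w y

/-! ### Hankel's formula for the reciprocal Gamma function -/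

lemma tendsto_exp_sub_exp_atTop {c : ℝ} (hc : 0 < c) (m : ℝ) :
    Filter.Tendsto (fun y : ℝ => 1 * Real.exp (m * y - c * Real.exp y)) Filter.atTop (nhds 0) := by
  simpa only [one_mul] using! Real.tendsto_exp_atBot.comp (tendsto_mul_sub_mul_exp_atBot hc m)

lemma norm_hankelKernel_le_left {y L : ℝ} (hy : y ≤ L) (w t : ℝ) :
    ‖hankelKernel w (y + t * Complex.I)‖ ≤ Real.exp (Real.exp L) * Real.exp ((1 - w) * y) := by
  rw [norm_hankelKernel, ← Real.exp_add]
  refine Real.exp_le_exp.2 (add_le_add_left ?_ _)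
  calc Real.exp y * Real.cos t ≤ Real.exp y * 1 := by
        gcongr
        exact Real.cos_le_one t
    _ ≤ Real.exp L := by simpa using hy

open Set in
lemma integrableOn_hankelKernel_left {w : ℝ} (hw : w < 1) (t L : ℝ) :
    IntegrableOn (fun y : ℝ => hankelKernel w (y + t * Complex.I)) (Iic L) := by
  have hg : IntegrableOn (fun y => Real.exp (Real.exp L) * Real.exp ((1 - w) * y)) (Iic L) :=
    (integrableOn_exp_mul_Iic (by linarith) L).const_mul _
  refine Integrable.mono' hg (by fun_prop) ?_
  filter_upwards [ae_restrict_mem measurableSet_Iic] with y hy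
  exact norm_hankelKernel_le_left hy w t

open Filter Topology in
lemma tendsto_exp_mul_atBot {w : ℝ} (hw : w < 1) (C : ℝ) :
    Tendsto (fun y : ℝ => C * Real.exp ((1 - w) * y)) atBot (𝓝 0) := by
  have : Tendsto (fun y : ℝ => (1 - w) * y) atBot atBot :=
    tendsto_id.const_mul_atBot (by linarith)
  simpa using (Real.tendsto_exp_atBot.comp this).const_mul C

open Filter Topology Set Complex in
/-- For `w < 1` the kernel is integrable at `-∞`, so the vertical side can be moved there. -/
lemma hankelIntegral_eq_lines {ψ w : ℝ} (h0 : 0 ≤ ψ) (hψ : Real.cos ψ < 0) (hw : w < 1) (L : ℝ) :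
    hankelIntegral ψ L (hankelKernel w) = (∫ y : ℝ, hankelKernel w (y + ψ * I))
      - ∫ y : ℝ, hankelKernel w (y + (-ψ : ℝ) * I) := by
  have hψ' : Real.cos (-ψ) < 0 := by rwa [Real.cos_neg]
  have key := halfStrip_integral_left (G := hankelKernel w) (a := L) (c := -ψ) (d := ψ)
    (by linarith) (differentiable_hankelKernel w).differentiableOn
    (integrableOn_hankelKernel_left hw _ _) (integrableOn_hankelKernel_left hw _ _)
    (tendsto_exp_mul_atBot hw (Real.exp (Real.exp L)))
    (by filter_upwards [eventually_le_atBot L] with R hR y _ using norm_hankelKernel_le_left hR w y)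
  rw [hankelIntegral, ← key,
    ← intervalIntegral.integral_Iic_add_Ioi (integrableOn_hankelKernel_left hw ψ L)
      (integrableOn_hankelKernel hψ w L),
    ← intervalIntegral.integral_Iic_add_Ioi (integrableOn_hankelKernel_left hw (-ψ) L)
      (integrableOn_hankelKernel hψ' w L)]
  ring

open Filter Topology Set Complex in
/-- The integral of the kernel over a horizontal line does not depend on the line, as long as the
line stays where `exp (e^u)` decays. -/
lemma integral_hankelKernel_line_eq {c d k w : ℝ} (hk : 0 < k) (hcd : c ≤ d)
    (hcos : ∀ t ∈ Icc c d, Real.cos t ≤ -k) (hw : w < 1) :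
    ∫ y : ℝ, hankelKernel w (y + c * I) = ∫ y : ℝ, hankelKernel w (y + d * I) := by
  have hc := hcos c ⟨le_rfl, hcd⟩
  have hd := hcos d ⟨hcd, le_rfl⟩
  have k1 := halfStrip_integral_left (G := hankelKernel w) (a := 0) (c := c) (d := d)
    hcd (differentiable_hankelKernel w).differentiableOn
    (integrableOn_hankelKernel_left hw _ _) (integrableOn_hankelKernel_left hw _ _)
    (tendsto_exp_mul_atBot hw (Real.exp (Real.exp 0)))
    (by filter_upwards [eventually_le_atBot 0] with R hR y _ using norm_hankelKernel_le_left hR w y)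
  have k2 := halfStrip_integral (G := hankelKernel w) (a := 0) (c := c) (d := d)
    hcd (differentiable_hankelKernel w).differentiableOn
    (integrableOn_hankelKernel (by linarith) _ _) (integrableOn_hankelKernel (by linarith) _ _)
    (tendsto_exp_sub_exp_atTop hk (1 - w)) (.of_forall fun R y hy => by
      rw [norm_hankelKernel, one_mul]
      refine Real.exp_le_exp.2 ?_
      nlinarith [Real.exp_pos R, hcos y hy])
  rw [← intervalIntegral.integral_Iic_add_Ioi (integrableOn_hankelKernel_left hw c 0)
      (integrableOn_hankelKernel (by linarith) w 0),
    ← intervalIntegral.integral_Iic_add_Ioi (integrableOn_hankelKernel_left hw d 0)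
      (integrableOn_hankelKernel (by linarith) w 0)]
  linear_combination k2 - k1

open Set in
lemma integral_exp_mul_exp_neg_exp (a : ℝ) :
    ∫ y : ℝ, Real.exp (a * y - Real.exp y) = ∫ t in Ioi (0 : ℝ), Real.exp (-t) * t ^ (a - 1) := by
  have h := integral_image_eq_integral_abs_deriv_smul (MeasurableSet.univ (α := ℝ))
    (fun x _ => (Real.hasDerivAt_exp x).hasDerivWithinAt) Real.exp_injective.injOn
    (fun t => Real.exp (-t) * t ^ (a - 1))
  rw [image_univ, Real.range_exp] at h
  rw [h, setIntegral_univ]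
  refine integral_congr_ae (.of_forall fun y => ?_)
  simp only [abs_of_pos (Real.exp_pos y), smul_eq_mul]
  rw [← Real.exp_mul, ← Real.exp_add, ← Real.exp_add]
  ring_nf

open Complex in
lemma integral_hankelKernel_pi {w : ℝ} (hw : w < 1) {s : ℝ} (hs : Real.cos s = -1)
    (hs' : Real.sin s = 0) :
    ∫ y : ℝ, hankelKernel w (y + s * I) = cexp ((1 - w) * (s * I)) * Real.Gamma (1 - w) := by
  have hexp : cexp (s * I) = -1 := by
    rw [exp_mul_I, ← ofReal_cos, ← ofReal_sin, hs, hs']; simp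
  have : ∀ y : ℝ, hankelKernel w (y + s * I)
      = cexp ((1 - w) * (s * I)) * (Real.exp ((1 - w) * y - Real.exp y) : ℝ) := by
    intro y
    rw [hankelKernel, Complex.exp_add (y : ℂ), hexp]
    push_cast
    rw [← Complex.exp_add]
    ring_nf
  simp_rw [this]
  rw [integral_const_mul, integral_complex_ofReal, integral_exp_mul_exp_neg_exp,
    Real.Gamma_eq_integral (by linarith)]

open Complex Set in
/-- Hankel's formula for `0 < w < 1`: collapsing the contour onto the lines `Im u = ±π` gives
`sin (π w) Γ(1 - w) / π`, which is `1 / Γ(w)` by the reflection formula. -/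
lemma hankelIntegral_kernel_of_lt_one {ψ w : ℝ} (hψ : Real.pi / 2 < ψ) (hψ' : ψ ≤ Real.pi)
    (hw0 : 0 < w) (hw : w < 1) (L : ℝ) :
    hankelIntegral ψ L (hankelKernel w) = 2 * Real.pi * I / Real.Gamma w := by
  have hπ := Real.pi_pos
  have hcos : Real.cos ψ < 0 :=
    Real.cos_neg_of_pi_div_two_lt_of_lt hψ (by linarith)
  have hle : ∀ t ∈ Icc ψ Real.pi, Real.cos t ≤ -(-Real.cos ψ) := fun t ht => by
    rw [neg_neg]
    exact Real.cos_le_cos_of_nonneg_of_le_pi (by linarith) ht.2 ht.1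
  have hle' : ∀ t ∈ Icc (-Real.pi) (-ψ), Real.cos t ≤ -(-Real.cos ψ) := fun t ht => by
    rw [← Real.cos_neg t]
    exact hle _ ⟨by linarith [ht.2], by linarith [ht.1]⟩
  rw [hankelIntegral_eq_lines (by linarith) hcos hw,
    integral_hankelKernel_line_eq (neg_pos.2 hcos) hψ' hle hw,
    ← integral_hankelKernel_line_eq (neg_pos.2 hcos) (neg_le_neg hψ') hle' hw,
    integral_hankelKernel_pi hw (by simp) (by simp), integral_hankelKernel_pi hw (by simp) (by simp)]
  have hΓ := Real.Gamma_mul_Gamma_one_sub w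
  have hsin : Real.sin (Real.pi * w) ≠ 0 :=
    (Real.sin_pos_of_pos_of_lt_pi (by positivity) (by nlinarith)).ne'
  have hΓw : Real.Gamma w ≠ 0 := (Real.Gamma_pos_of_pos hw0).ne'
  have e1 : Real.Gamma (1 - w) = Real.pi / Real.sin (Real.pi * w) / Real.Gamma w := by
    rw [← hΓ]; field_simp
  have e2 : cexp ((1 - w) * (Real.pi * I)) - cexp ((1 - w) * ((-Real.pi : ℝ) * I))
      = 2 * I * (Real.sin (Real.pi * w) : ℝ) := by
    have h1 : ((1 : ℂ) - w) * (Real.pi * I) = ((Real.pi - Real.pi * w : ℝ) : ℂ) * I := by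
      push_cast; ring
    have h2 : ((1 : ℂ) - w) * ((-Real.pi : ℝ) * I) = ((-(Real.pi - Real.pi * w) : ℝ) : ℂ) * I := by
      push_cast; ring
    rw [h1, h2, exp_mul_I, exp_mul_I, ← ofReal_cos, ← ofReal_sin, ← ofReal_cos, ← ofReal_sin,
      Real.cos_neg, Real.sin_neg, Real.sin_pi_sub]
    push_cast
    ring
  rw [← sub_mul, e2, e1]
  have hsinC : ((Real.sin (Real.pi * w) : ℝ) : ℂ) ≠ 0 := ofReal_ne_zero.2 hsin
  rw [ofReal_div, ofReal_div]
  field_simp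

open Filter Topology Set Complex in
/-- Integration by parts along the contour: the analogue of `Γ(w + 1) = w Γ(w)`. -/
lemma hankelIntegral_kernel_add_one {ψ : ℝ} (hψ : Real.cos ψ < 0) (w L : ℝ) :
    hankelIntegral ψ L (hankelKernel w) = w * hankelIntegral ψ L (hankelKernel (w + 1)) := by
  have hψ' : Real.cos (-ψ) < 0 := by rwa [Real.cos_neg]
  have hder : ∀ u : ℂ, HasDerivAt (hankelKernel (w + 1))
      (hankelKernel w u - w * hankelKernel (w + 1) u) u := by
    intro u
    unfold hankelKernel
    have h1 : HasDerivAt (fun u : ℂ => cexp u + (1 - ((w + 1 : ℝ) : ℂ)) * u)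
        (cexp u + (1 - ((w + 1 : ℝ) : ℂ)) * 1) u :=
      (hasDerivAt_exp u).add ((hasDerivAt_id u).const_mul _)
    refine h1.cexp.congr_deriv ?_
    have : cexp u + (1 - (w : ℂ)) * u = (cexp u + (1 - ((w + 1 : ℝ) : ℂ)) * u) + u := by
      push_cast; ring
    rw [this, Complex.exp_add _ u]
    push_cast
    ring
  have ray : ∀ t : ℝ, Real.cos t < 0 →
      (∫ y in Ioi L, hankelKernel w (y + t * I)) - w * ∫ y in Ioi L, hankelKernel (w + 1) (y + t * I)
        = - hankelKernel (w + 1) (L + t * I) := by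
    intro t ht
    have hd : ∀ y : ℝ, HasDerivAt (fun y : ℝ => hankelKernel (w + 1) (y + t * I))
        (hankelKernel w (y + t * I) - w * hankelKernel (w + 1) (y + t * I)) y := fun y =>
      ((hder _).comp_add_const (y : ℂ) (t * I)).comp_ofReal
    have i1 := integrableOn_hankelKernel ht w L
    have i2 := (integrableOn_hankelKernel ht (w + 1) L).const_mul (w : ℂ)
    have ht0 : Tendsto (fun y : ℝ => hankelKernel (w + 1) (y + t * I)) atTop (𝓝 0) :=
      squeeze_zero_norm (fun y => norm_hankelKernel_le le_rfl (w + 1) y)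
        (tendsto_exp_sub_exp_atTop (neg_pos.2 ht) _)
    have := integral_Ioi_of_hasDerivAt_of_tendsto' (a := L) (fun y _ => hd y) (i1.sub i2) ht0
    rw [integral_sub i1 i2, integral_const_mul] at this
    rw [this, zero_sub]
  have vert : I * (∫ t in (-ψ)..ψ, hankelKernel w (L + t * I))
      - w * (I * ∫ t in (-ψ)..ψ, hankelKernel (w + 1) (L + t * I))
      = hankelKernel (w + 1) (L + ψ * I) - hankelKernel (w + 1) (L + (-ψ : ℝ) * I) := by
    have hd : ∀ t : ℝ, HasDerivAt (fun t : ℝ => hankelKernel (w + 1) (L + t * I))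
        ((hankelKernel w (L + t * I) - w * hankelKernel (w + 1) (L + t * I)) * (1 * I)) t := fun t =>
      ((hder _).comp (t : ℂ) (((hasDerivAt_id (t : ℂ)).mul_const I).const_add (L : ℂ))).comp_ofReal
    rw [← intervalIntegral.integral_eq_sub_of_hasDerivAt (fun t _ => hd t)
      (by apply Continuous.intervalIntegrable; fun_prop)]
    rw [intervalIntegral.integral_mul_const, intervalIntegral.integral_sub
      (by apply Continuous.intervalIntegrable; fun_prop)
      (by apply Continuous.intervalIntegrable; fun_prop), intervalIntegral.integral_const_mul]
    ring
  rw [hankelIntegral, hankelIntegral]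
  linear_combination ray ψ hψ - ray (-ψ) hψ' + vert

open Filter Topology Set Complex in
lemma continuous_hankelIntegral_kernel {ψ : ℝ} (hψ : Real.cos ψ < 0) :
    Continuous fun w => hankelIntegral ψ 0 (hankelKernel w) := by
  have hψ' : Real.cos (-ψ) < 0 := by rwa [Real.cos_neg]
  have hK : Continuous fun p : ℝ × ℂ => hankelKernel p.1 p.2 := by
    unfold hankelKernel; fun_prop
  have ray : ∀ t : ℝ, Real.cos t < 0 →
      Continuous fun w => ∫ y in Ioi (0 : ℝ), hankelKernel w (y + t * I) := by
    intro t ht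
    rw [continuous_iff_continuousAt]
    intro w₀
    refine continuousAt_of_dominated (bound := fun y => ‖hankelKernel (w₀ - 1) (y + t * I)‖)
      (.of_forall fun w => by fun_prop) ?_ (integrableOn_hankelKernel ht _ _).norm
      (.of_forall fun y => by fun_prop)
    filter_upwards [eventually_ge_nhds (show w₀ - 1 < w₀ by linarith)] with w hw
    filter_upwards [ae_restrict_mem measurableSet_Ioi] with y hy
    rw [norm_hankelKernel, norm_hankelKernel]
    refine Real.exp_le_exp.2 ?_
    have : 0 < y := hy
    nlinarith
  refine ((ray ψ hψ).sub (ray (-ψ) hψ')).add (continuous_const.mul ?_)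
  exact intervalIntegral.continuous_parametric_intervalIntegral_of_continuous' (by fun_prop) _ _

open Filter Topology Set Complex in
/-- **Hankel's formula** for the reciprocal Gamma function. -/
theorem hankelIntegral_kernel {ψ w L : ℝ} (hψ : Real.pi / 2 < ψ) (hψ' : ψ ≤ Real.pi)
    (hw : 0 < w) (hL : 0 ≤ L) :
    hankelIntegral ψ L (hankelKernel w) = 2 * Real.pi * I / Real.Gamma w := by
  have hπ := Real.pi_pos
  have hcos : Real.cos ψ < 0 :=
    Real.cos_neg_of_pi_div_two_lt_of_lt hψ (by linarith)
  have hcos' : Real.cos (-ψ) < 0 := by rwa [Real.cos_neg]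
  rw [← hankelIntegral_congr_left (by linarith) hL
    (differentiable_hankelKernel w).differentiableOn (integrableOn_hankelKernel hcos w 0)
    (integrableOn_hankelKernel hcos' w 0)]
  have hn : ∀ n : ℕ, ∀ w : ℝ, n < w → w < n + 1 →
      hankelIntegral ψ 0 (hankelKernel w) = 2 * Real.pi * I / Real.Gamma w := by
    intro n
    induction n with
    | zero =>
      intro w h1 h2
      exact hankelIntegral_kernel_of_lt_one hψ hψ' (by simpa using h1) (by simpa using h2) 0
    | succ n ih =>
      intro w h1 h2
      push_cast at h1 h2
      have hw1 : w - 1 ≠ 0 := by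
        have : (0 : ℝ) ≤ n := n.cast_nonneg
        linarith
      have h3 := hankelIntegral_kernel_add_one hcos (w - 1) 0
      rw [ih (w - 1) (by linarith) (by linarith), sub_add_cancel] at h3
      have h4 := Real.Gamma_add_one hw1
      rw [sub_add_cancel] at h4
      have hw1' : ((w - 1 : ℝ) : ℂ) ≠ 0 := ofReal_ne_zero.2 hw1
      rw [h4, ofReal_mul, mul_comm ((w - 1 : ℝ) : ℂ), ← div_div, h3, mul_div_cancel_left₀ _ hw1']
  have hd : ∀ᶠ v in 𝓝[≠] w, hankelIntegral ψ 0 (hankelKernel v) = 2 * Real.pi * I / Real.Gamma v := by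
    have e1 : ∀ᶠ v in 𝓝[≠] w, 0 < v := nhdsWithin_le_nhds (eventually_gt_nhds hw)
    have e2 : ∀ᶠ v in 𝓝[≠] w, (⌈w⌉ : ℝ) - 1 < v :=
      nhdsWithin_le_nhds (eventually_gt_nhds (by linarith [Int.ceil_lt_add_one w]))
    have e3 : ∀ᶠ v in 𝓝[≠] w, v < (⌊w⌋ : ℝ) + 1 :=
      nhdsWithin_le_nhds (eventually_lt_nhds (Int.lt_floor_add_one w))
    filter_upwards [e1, e2, e3, self_mem_nhdsWithin] with v h1 h2 h3 h4
    refine hn ⌊v⌋₊ v (lt_of_le_of_ne (Nat.floor_le h1.le) fun hv => h4 ?_) (Nat.lt_floor_add_one v)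
    rw [← hv] at h2 h3
    have h5 : ⌈w⌉ ≤ (⌊v⌋₊ : ℤ) := by
      have : ⌈w⌉ - 1 < (⌊v⌋₊ : ℤ) := by exact_mod_cast h2
      omega
    have h6 : (⌊v⌋₊ : ℤ) ≤ ⌊w⌋ := by
      have : (⌊v⌋₊ : ℤ) < ⌊w⌋ + 1 := by exact_mod_cast h3
      omega
    have h7 := Int.ceil_le.1 h5
    have h8 := Int.le_floor.1 h6
    rw [mem_singleton_iff, ← hv]
    push_cast at h7 h8
    exact le_antisymm h8 h7
  have t1 := ((continuous_hankelIntegral_kernel hcos).tendsto w).mono_left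
    (nhdsWithin_le_nhds (s := {w}ᶜ))
  have hΓ : ContinuousAt Real.Gamma w :=
    (Real.differentiableAt_Gamma fun m => by
      have : (0 : ℝ) ≤ m := m.cast_nonneg
      linarith).continuousAt
  have t2 : Tendsto (fun v => 2 * Real.pi * I / (Real.Gamma v : ℂ)) (𝓝[≠] w)
      (𝓝 (2 * Real.pi * I / Real.Gamma w)) :=
    (tendsto_const_nhds.div ((continuous_ofReal.tendsto _).comp hΓ)
      (ofReal_ne_zero.2 (Real.Gamma_pos_of_pos hw).ne')).mono_left nhdsWithin_le_nhds
  exact tendsto_nhds_unique (t1.congr' hd) t2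

/-! ### Contour integral and decay of the Mittag-Leffler function -/

/-- The integrand of the contour integral representing `E_{α,β}(z)` in the logarithmic variable;
with `t = e^u` it is `e^t t^{α-β} / (t^α - z) dt`. -/
noncomputable def mittagLefflerKernel (α β : ℝ) (z u : ℂ) : ℂ :=
  hankelKernel β u / (1 - z * Complex.exp (-(α * u)))

lemma hankelKernel_add (a b : ℝ) (u : ℂ) :
    hankelKernel (a + b) u = hankelKernel b u * Complex.exp (-(a * u)) := by
  rw [hankelKernel, hankelKernel, ← Complex.exp_add]
  push_cast
  ring_nf

lemma hankelKernel_mul_add (α β : ℝ) (k : ℕ) (u : ℂ) :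
    hankelKernel (α * k + β) u = hankelKernel β u * Complex.exp (-(α * u)) ^ k := by
  rw [hankelKernel_add, ← Complex.exp_nat_mul]
  push_cast
  ring_nf

open Set Complex in
/-- Termwise integration of the geometric series for the kernel along a curve on which the ratio
stays away from `1`. -/
lemma hasSum_integral_hankelKernel {α β q : ℝ} {z : ℂ} {μ : Measure ℝ} {c : ℝ → ℂ}
    (hc : Continuous c) (hq : q < 1) (hzc : ∀ᵐ y ∂μ, ‖z * cexp (-(α * c y))‖ ≤ q)
    (hint : Integrable (fun y => hankelKernel β (c y)) μ) :
    HasSum (fun k : ℕ => z ^ k * ∫ y, hankelKernel (α * k + β) (c y) ∂μ)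
      (∫ y, mittagLefflerKernel α β z (c y) ∂μ) := by
  have hF : ∀ (k : ℕ) (y : ℝ), z ^ k * hankelKernel (α * k + β) (c y)
      = hankelKernel β (c y) * (z * cexp (-(α * c y))) ^ k := by
    intro k y
    rw [hankelKernel_mul_add]
    ring
  have hb : ∀ k : ℕ, ∀ᵐ y ∂μ, ‖z ^ k * hankelKernel (α * k + β) (c y)‖
      ≤ ‖hankelKernel β (c y)‖ * q ^ k := by
    intro k
    filter_upwards [hzc] with y hy
    rw [hF, norm_mul, norm_pow]
    gcongr
  have hi : ∀ k : ℕ, Integrable (fun y => z ^ k * hankelKernel (α * k + β) (c y)) μ := fun k =>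
    (hint.norm.mul_const (q ^ k)).mono' (by fun_prop) (hb k)
  rcases Filter.eq_or_neBot (ae μ) with h0 | h0
  · rw [ae_eq_bot] at h0
    simp [h0]
  obtain ⟨y₀, hy₀⟩ := hzc.exists
  have hq0 : 0 ≤ q := (norm_nonneg _).trans hy₀
  have hs : Summable fun k : ℕ => ∫ y, ‖z ^ k * hankelKernel (α * k + β) (c y)‖ ∂μ := by
    refine Summable.of_nonneg_of_le (fun k => integral_nonneg fun y => norm_nonneg _) (fun k => ?_)
      ((summable_geometric_of_lt_one hq0 hq).mul_left (∫ y, ‖hankelKernel β (c y)‖ ∂μ))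
    rw [← integral_mul_const]
    exact integral_mono_ae (hi k).norm (hint.norm.mul_const _) (hb k)
  have key := hasSum_integral_of_summable_integral_norm hi hs
  have e : ∫ y, mittagLefflerKernel α β z (c y) ∂μ
      = ∫ y, ∑' k : ℕ, z ^ k * hankelKernel (α * k + β) (c y) ∂μ := ?_
  · rw [e]
    exact key.congr_fun fun k => (integral_const_mul _ _).symm
  refine integral_congr_ae ?_
  filter_upwards [hzc] with y hy
  simp_rw [hF]
  rw [tsum_mul_left, tsum_geometric_of_norm_lt_one (hy.trans_lt hq), mittagLefflerKernel,
    div_eq_mul_inv]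

open Set Complex in
lemma norm_mul_exp_neg_mul (α y t : ℝ) (z : ℂ) :
    ‖z * cexp (-(α * (y + t * I)))‖ = ‖z‖ * Real.exp (-(α * y)) := by
  rw [norm_mul, Complex.norm_exp]
  simp

open Set Complex in
/-- The Mittag-Leffler series as a contour integral, for a contour lying outside the circle
`|t| = |z|^{1/α}`. -/
lemma hasSum_mittagLeffler_hankelIntegral {α β ψ L : ℝ} {z : ℂ} (hα : 0 < α) (hβ : 0 < β)
    (hψ : Real.pi / 2 < ψ) (hψ' : ψ ≤ Real.pi) (hL : 0 ≤ L) (hz : ‖z‖ < Real.exp (α * L)) :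
    HasSum (fun k : ℕ => z ^ k / (Real.Gamma (α * k + β) : ℂ))
      (hankelIntegral ψ L (mittagLefflerKernel α β z) / (2 * Real.pi * I)) := by
  have hπ := Real.pi_pos
  have hcos : Real.cos ψ < 0 :=
    Real.cos_neg_of_pi_div_two_lt_of_lt hψ (by linarith)
  have hcos' : Real.cos (-ψ) < 0 := by rwa [Real.cos_neg]
  have hq : ‖z‖ * Real.exp (-(α * L)) < 1 := by
    rw [Real.exp_neg, ← div_eq_mul_inv, div_lt_one (Real.exp_pos _)]
    exact hz
  have ray : ∀ t : ℝ, Real.cos t < 0 →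
      HasSum (fun k : ℕ => z ^ k * ∫ y in Ioi L, hankelKernel (α * k + β) (y + t * I))
        (∫ y in Ioi L, mittagLefflerKernel α β z (y + t * I)) := by
    intro t ht
    refine hasSum_integral_hankelKernel (c := fun y => (y : ℂ) + t * I) (by fun_prop) hq ?_
      (integrableOn_hankelKernel ht β L)
    filter_upwards [ae_restrict_mem measurableSet_Ioi] with y hy
    rw [norm_mul_exp_neg_mul]
    have : L < y := hy
    gcongr
  have vert : HasSum (fun k : ℕ => z ^ k * ∫ t in (-ψ)..ψ, hankelKernel (α * k + β) (L + t * I))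
        (∫ t in (-ψ)..ψ, mittagLefflerKernel α β z (L + t * I)) := by
    simp_rw [intervalIntegral.integral_of_le (show -ψ ≤ ψ by linarith)]
    refine hasSum_integral_hankelKernel (c := fun t : ℝ => (L : ℂ) + t * I) (by fun_prop) hq
      (.of_forall fun t => (norm_mul_exp_neg_mul _ _ _ _).le) ?_
    exact (Continuous.integrableOn_Icc (by fun_prop)).mono_set Ioc_subset_Icc_self
  have key := (((ray ψ hcos).sub (ray (-ψ) hcos')).add (vert.mul_left I)).div_const
    (2 * Real.pi * I)
  refine key.congr_fun fun k => ?_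
  have hk : 0 < α * k + β := by positivity
  have h1 := hankelIntegral_kernel hψ hψ' hk hL
  have h2 : (2 * Real.pi * I : ℂ) ≠ 0 := by simp [hπ.ne']
  have h3 : ((Real.Gamma (α * k + β) : ℝ) : ℂ) ≠ 0 :=
    ofReal_ne_zero.2 (Real.Gamma_pos_of_pos hk).ne'
  rw [hankelIntegral] at h1
  rw [← mul_sub, mul_left_comm I, ← mul_add, h1]
  field_simp

lemma summable_mittagLeffler {α β : ℝ} (hα : 0 < α) (hβ : 0 < β) (z : ℂ) :
    Summable fun k : ℕ => z ^ k / (Real.Gamma (α * k + β) : ℂ) := by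
  have hπ := Real.pi_pos
  have h1 : ‖z‖ < Real.exp (α * (‖z‖ / α)) := by
    rw [mul_div_cancel₀ _ hα.ne']
    linarith [Real.add_one_le_exp ‖z‖]
  exact (hasSum_mittagLeffler_hankelIntegral (ψ := Real.pi) hα hβ (by linarith) le_rfl
    (div_nonneg (norm_nonneg z) hα.le) h1).summable

open Set Complex in
/-- Points of argument `θ` with `cos θ ≤ cos ε` keep a distance from the positive half-line. -/
lemma mul_sin_le_norm_sub_mul_exp {a r θ ε : ℝ} (ha : 0 ≤ a) (hr : 0 ≤ r)
    (hθ : Real.cos θ ≤ Real.cos ε) : r * Real.sin ε ≤ ‖(a : ℂ) - r * cexp (θ * I)‖ := by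
  refine le_of_sq_le_sq ?_ (norm_nonneg _)
  have h1 : ‖(a : ℂ) - r * cexp (θ * I)‖ ^ 2
      = (a - r * Real.cos θ) ^ 2 + (r * Real.sin θ) ^ 2 := by
    rw [← normSq_eq_norm_sq, normSq_apply, exp_mul_I, ← ofReal_cos, ← ofReal_sin]
    simp only [sub_re, sub_im, mul_re, mul_im, add_re, add_im, ofReal_re, ofReal_im, I_re, I_im]
    ring
  rw [h1, mul_pow, mul_pow, Real.sin_sq, Real.sin_sq]
  nlinarith [sq_nonneg (a - r * Real.cos ε), mul_nonneg (mul_nonneg ha hr) (sub_nonneg.2 hθ)]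

lemma cos_le_cos_of_mem_Icc {ε x : ℝ} (hε : 0 ≤ ε) (h1 : ε ≤ x) (h2 : x ≤ 2 * Real.pi - ε) :
    Real.cos x ≤ Real.cos ε := by
  rcases le_total x Real.pi with h | h
  · exact Real.cos_le_cos_of_nonneg_of_le_pi hε h h1
  · rw [← Real.cos_two_pi_sub]
    exact Real.cos_le_cos_of_nonneg_of_le_pi hε (by linarith) (by linarith)

open Set Complex in
/-- Inside the strip `|Im u| ≤ ψ` the values `e^{αu}` stay in the sector `|arg| ≤ αψ`, hence away
from `z = r e^{iφ}` when `φ` lies in the complementary sector. -/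
lemma norm_one_sub_ge {α ψ ε φ r y t : ℝ} (hα : 0 < α) (hε : 0 ≤ ε) (hr : 0 ≤ r)
    (hφ : α * ψ + ε ≤ φ) (hφ' : φ ≤ 2 * Real.pi - α * ψ - ε) (ht : t ∈ Icc (-ψ) ψ) :
    r * Real.sin ε * Real.exp (-(α * y))
      ≤ ‖1 - r * cexp (φ * I) * cexp (-(α * (y + t * I)))‖ := by
  have h1 : 1 - r * cexp (φ * I) * cexp (-(α * (y + t * I)))
      = (Real.exp (-(α * y)) : ℝ) *
        (((Real.exp (α * y) : ℝ) : ℂ) - r * cexp ((φ - α * t : ℝ) * I)) := by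
    push_cast
    rw [mul_sub, ← Complex.exp_add, mul_left_comm, ← Complex.exp_add, mul_assoc,
      ← Complex.exp_add]
    ring_nf
    simp [sub_eq_add_neg, add_comm]
  rw [h1, norm_mul, norm_real, Real.norm_of_nonneg (Real.exp_nonneg _), mul_comm]
  refine mul_le_mul_of_nonneg_left ?_ (Real.exp_nonneg _)
  refine mul_sin_le_norm_sub_mul_exp (Real.exp_nonneg _) hr (cos_le_cos_of_mem_Icc hε ?_ ?_)
  · nlinarith [ht.2]
  · nlinarith [ht.1]

open Set Complex in
/-- Decay of the Mittag-Leffler function along rays: `E_{α,β}(r e^{iφ}) = O(1 / r)`, uniformly for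
`φ` in a closed sector on which `|arg z| > πα/2`. -/
theorem norm_mittagLeffler_le {α β ψ ε : ℝ} (hα : 0 < α) (hβ : 0 < β)
    (hψ : Real.pi / 2 < ψ) (hψ' : ψ ≤ Real.pi) (hε : 0 < ε) (hε' : ε < Real.pi) :
    ∃ C : ℝ, ∀ r φ : ℝ, 0 < r → α * ψ + ε ≤ φ → φ ≤ 2 * Real.pi - α * ψ - ε →
      ‖mittagLeffler α β (r * cexp (φ * I))‖ ≤ C / r := by
  have hπ := Real.pi_pos
  have hcos : Real.cos ψ < 0 :=
    Real.cos_neg_of_pi_div_two_lt_of_lt hψ (by linarith)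
  have hcos' : Real.cos (-ψ) < 0 := by rwa [Real.cos_neg]
  have hsin : 0 < Real.sin ε := Real.sin_pos_of_pos_of_lt_pi hε hε'
  refine ⟨((∫ y in Ioi (0 : ℝ), ‖hankelKernel (-α + β) (y + ψ * I)‖)
    + (∫ y in Ioi (0 : ℝ), ‖hankelKernel (-α + β) (y + (-ψ : ℝ) * I)‖)
    + ∫ t in (-ψ)..ψ, ‖hankelKernel (-α + β) ((0 : ℝ) + t * I)‖) / Real.sin ε, ?_⟩
  intro r φ hr h1 h2
  set z : ℂ := r * cexp (φ * I) with hz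
  have hrs : 0 < r * Real.sin ε := by positivity
  have hden : ∀ y t : ℝ, t ∈ Icc (-ψ) ψ → r * Real.sin ε * Real.exp (-(α * y))
      ≤ ‖1 - z * cexp (-(α * (y + t * I)))‖ := fun y t ht =>
    norm_one_sub_ge hα hε.le hr.le h1 h2 ht
  have hden0 : ∀ y t : ℝ, t ∈ Icc (-ψ) ψ → 1 - z * cexp (-(α * (y + t * I))) ≠ 0 := fun y t ht =>
    norm_pos_iff.1 (lt_of_lt_of_le (by positivity) (hden y t ht))
  have hbound : ∀ y t : ℝ, t ∈ Icc (-ψ) ψ → ‖mittagLefflerKernel α β z (y + t * I)‖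
      ≤ (r * Real.sin ε)⁻¹ * ‖hankelKernel (-α + β) (y + t * I)‖ := by
    intro y t ht
    have h3 : ‖cexp (-((-α : ℝ) * ((y : ℂ) + t * I)))‖ = Real.exp (α * y) := by
      rw [Complex.norm_exp]; simp
    rw [mittagLefflerKernel, norm_div, hankelKernel_add, norm_mul, h3]
    refine (div_le_div_of_nonneg_left (norm_nonneg _) (by positivity) (hden y t ht)).trans_eq ?_
    rw [Real.exp_neg]
    field_simp
  have hψm : ψ ∈ Icc (-ψ) ψ := ⟨by linarith, le_rfl⟩
  have hψm' : -ψ ∈ Icc (-ψ) ψ := ⟨le_rfl, by linarith⟩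
  have ray : ∀ t ∈ Icc (-ψ) ψ, Real.cos t < 0 →
      IntegrableOn (fun y : ℝ => mittagLefflerKernel α β z (y + t * I)) (Ioi 0) := by
    intro t ht hct
    refine ((integrableOn_hankelKernel hct (-α + β) 0).norm.const_mul _).mono'
      (Continuous.aestronglyMeasurable ?_) (.of_forall fun y => hbound y t ht)
    unfold mittagLefflerKernel
    exact Continuous.div (by fun_prop) (by fun_prop) fun y => hden0 y t ht
  have hE : mittagLeffler α β z = hankelIntegral ψ 0 (mittagLefflerKernel α β z)
      / (2 * Real.pi * I) := by
    have hL : 0 ≤ r / α := by positivity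
    have hzn : ‖z‖ < Real.exp (α * (r / α)) := by
      rw [mul_div_cancel₀ _ hα.ne', hz, norm_mul, norm_exp_ofReal_mul_I, norm_real,
        Real.norm_of_nonneg hr.le]
      linarith [Real.add_one_le_exp r]
    rw [mittagLeffler, (hasSum_mittagLeffler_hankelIntegral hα hβ hψ hψ' hL hzn).tsum_eq,
      ← hankelIntegral_congr_left (by linarith) hL ?_ (ray ψ hψm hcos) (ray (-ψ) hψm' hcos')]
    intro u hu
    have hu0 := hden0 u.re u.im hu.2
    rw [re_add_im] at hu0
    unfold mittagLefflerKernel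
    exact ((differentiable_hankelKernel β u).div (by fun_prop) hu0).differentiableWithinAt
  have b1 : ∀ t ∈ Icc (-ψ) ψ, Real.cos t < 0 →
      ‖∫ y in Ioi (0 : ℝ), mittagLefflerKernel α β z (y + t * I)‖
        ≤ (r * Real.sin ε)⁻¹ * ∫ y in Ioi (0 : ℝ), ‖hankelKernel (-α + β) (y + t * I)‖ := by
    intro t ht hct
    rw [← integral_const_mul]
    exact norm_integral_le_of_norm_le
      ((integrableOn_hankelKernel hct (-α + β) 0).norm.const_mul _)
      (.of_forall fun y => hbound y t ht)
  have b2 : ‖∫ t in (-ψ)..ψ, mittagLefflerKernel α β z ((0 : ℝ) + t * I)‖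
      ≤ (r * Real.sin ε)⁻¹ * ∫ t in (-ψ)..ψ, ‖hankelKernel (-α + β) ((0 : ℝ) + t * I)‖ := by
    rw [← intervalIntegral.integral_const_mul]
    refine intervalIntegral.norm_integral_le_of_norm_le (by linarith)
      (.of_forall fun t ht => hbound 0 t (Ioc_subset_Icc_self ht)) ?_
    apply Continuous.intervalIntegrable
    fun_prop
  have hpi : 1 ≤ ‖(2 * Real.pi * I : ℂ)‖ := by
    rw [norm_mul, norm_mul, norm_I, norm_real, Real.norm_of_nonneg hπ.le]
    simp only [Complex.norm_ofNat, mul_one]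
    linarith [Real.pi_gt_three]
  rw [hE, norm_div]
  refine (div_le_self (norm_nonneg _) hpi).trans ?_
  rw [hankelIntegral]
  refine (norm_add_le _ _).trans ?_
  rw [norm_mul, norm_I, one_mul]
  refine (add_le_add ((norm_sub_le _ _).trans (add_le_add (b1 ψ hψm hcos) (b1 (-ψ) hψm' hcos'))) b2).trans_eq ?_
  field_simp

open Set Complex in
/-- The Mittag-Leffler function is entire. -/
theorem differentiable_mittagLeffler {α β : ℝ} (hα : 0 < α) (hβ : 0 < β) :
    Differentiable ℂ (mittagLeffler α β) := by
  intro z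
  have hs : Summable fun k : ℕ => ((‖z‖ + 1 : ℝ) : ℂ) ^ k / (Real.Gamma (α * k + β) : ℂ) :=
    summable_mittagLeffler hα hβ _
  have h := differentiableOn_tsum_of_summable_norm (F := fun (k : ℕ) (z : ℂ) =>
    z ^ k / (Real.Gamma (α * k + β) : ℂ)) (U := Metric.ball 0 (‖z‖ + 1)) hs.norm
    (fun k => by fun_prop) Metric.isOpen_ball (fun k w hw => by
      rw [mem_ball_zero_iff] at hw
      have hz : ‖((‖z‖ + 1 : ℝ) : ℂ)‖ = ‖z‖ + 1 := by
        rw [norm_real, Real.norm_of_nonneg (by positivity)]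
      rw [norm_div, norm_div, norm_pow, norm_pow, hz]
      gcongr)
  exact h.differentiableAt (Metric.isOpen_ball.mem_nhds (by simp))

/-! ### Stieltjes representation on a strip -/

open Set in
lemma integrable_exp_neg_mul_abs {k : ℝ} (hk : 0 < k) :
    Integrable fun y : ℝ => Real.exp (-(k * |y|)) := by
  rw [← integrableOn_univ, ← Iic_union_Ioi (a := (0 : ℝ)), integrableOn_union]
  constructor
  · refine (integrableOn_exp_mul_Iic hk 0).congr_fun (fun y hy => ?_) measurableSet_Iic
    simp only [abs_of_nonpos (mem_Iic.1 hy), mul_neg, neg_neg]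
  · refine (integrableOn_exp_mul_Ioi (neg_neg_of_pos hk) 0).congr_fun (fun y hy => ?_)
      measurableSet_Ioi
    simp only [abs_of_pos (mem_Ioi.1 hy), neg_mul]

/-- The jump of `H` between the lower and the upper side of the strip `|Im u| ≤ π`; in the variable
`v = e^u` these are the two sides of the cut along the negative half-line. -/
noncomputable def stripJump (H : ℂ → ℂ) (y : ℝ) : ℂ :=
  H (y + (-Real.pi : ℝ) * Complex.I) - H (y + Real.pi * Complex.I)

open Set Complex in
lemma norm_stripJump_le {H : ℂ → ℂ} {h₀ : ℂ} {C κ : ℝ}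
    (h1 : ∀ x t : ℝ, t ∈ Icc (-Real.pi) Real.pi → ‖H (x + t * I)‖ ≤ C * Real.exp (-(κ * x)))
    (h2 : ∀ x t : ℝ, x ≤ 0 → ‖H (x + t * I) - h₀‖ ≤ C * Real.exp (κ * x)) (y : ℝ) :
    ‖stripJump H y‖ ≤ 2 * C * Real.exp (-(κ * |y|)) := by
  have hπ := Real.pi_pos
  rcases le_total 0 y with hy | hy
  · rw [abs_of_nonneg hy]
    refine (norm_sub_le _ _).trans ?_
    linarith [h1 y (-Real.pi) ⟨le_rfl, by linarith⟩, h1 y Real.pi ⟨by linarith, le_rfl⟩]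
  · rw [abs_of_nonpos hy, mul_neg, neg_neg, stripJump, ← sub_sub_sub_cancel_right _ _ h₀]
    refine (norm_sub_le _ _).trans ?_
    linarith [h2 y (-Real.pi) hy, h2 y Real.pi hy]

open Filter Topology Set Complex in
/-- **Stieltjes representation** in logarithmic variables: an entire function decaying at the right
end of the strip `|Im u| ≤ π` and bounded at its left end is recovered on the real line from its
jump across the strip. In the variables `v = e^u`, `σ = e^y` the kernel is `dσ / (σ + v)`. -/
theorem integral_stripJump {H : ℂ → ℂ} {h₀ : ℂ} {C κ : ℝ} (hκ : 0 < κ) (hH : Differentiable ℂ H)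
    (h1 : ∀ x t : ℝ, t ∈ Icc (-Real.pi) Real.pi → ‖H (x + t * I)‖ ≤ C * Real.exp (-(κ * x)))
    (h2 : ∀ x t : ℝ, x ≤ 0 → ‖H (x + t * I) - h₀‖ ≤ C * Real.exp (κ * x)) (u : ℝ) :
    ∫ y : ℝ, stripJump H y * ((Real.exp y / (Real.exp y + Real.exp u) : ℝ) : ℂ)
      = 2 * Real.pi * I * H u := by
  have hπ := Real.pi_pos
  have hC : 0 ≤ C := by
    have := (norm_nonneg _).trans (h1 0 0 ⟨by linarith, hπ.le⟩)
    simpa using this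
  -- the quotient of the difference quotients removes the singularity at `u`
  set G : ℂ → ℂ := fun z => dslope H u z * (cexp z / dslope cexp u z) with hG
  have hGne : ∀ z : ℂ, z ≠ u → G z = (H z - H u) * cexp z / (cexp z - cexp u) := by
    intro z hz
    have hz' : z - u ≠ 0 := sub_ne_zero.2 hz
    simp only [hG, dslope_of_ne _ hz, slope_def_field]
    rw [div_div_eq_mul_div, div_mul_div_comm, ← mul_assoc, mul_div_mul_right _ _ hz' |>.symm]
    field_simp
  have hexp : ∀ x t : ℝ, ‖cexp (x + t * I)‖ = Real.exp x := by
    intro x t; rw [Complex.norm_exp]; simp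
  have hline : ∀ x s : ℝ, s ≠ 0 → Real.cos s = -1 → Real.sin s = 0 →
      G (x + s * I) = (H (x + s * I) - H u) * ((Real.exp x / (Real.exp x + Real.exp u) : ℝ) : ℂ) := by
    intro x s hs0 hs hs'
    have hne : (x + s * I : ℂ) ≠ u := fun h => hs0 (by simpa using congrArg Complex.im h)
    have he : cexp (x + s * I) = -cexp x := by
      rw [Complex.exp_add, exp_mul_I, ← ofReal_cos, ← ofReal_sin, hs, hs']; simp
    rw [hGne _ hne, he]
    push_cast
    rw [← neg_add', mul_neg, neg_div_neg_eq, mul_div_assoc]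
  have hGd : ∀ R : ℝ, DifferentiableOn ℂ G (uIcc (-R) R ×ℂ uIcc (-Real.pi) Real.pi) := by
    intro R z hz
    have hz2 : z.im ∈ Icc (-Real.pi) Real.pi := by
      rw [← uIcc_of_le (by linarith)]; exact hz.2
    have d1 : ∀ f : ℂ → ℂ, Differentiable ℂ f → DifferentiableAt ℂ (dslope f u) z := fun f hf =>
      ((differentiableOn_dslope univ_mem).2 hf.differentiableOn).differentiableAt univ_mem
    refine ((d1 H hH).mul (differentiable_exp.differentiableAt.div (d1 cexp differentiable_exp)
      ?_)).differentiableWithinAt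
    by_cases hzu : z = u
    · rw [hzu, dslope_same, Complex.deriv_exp]
      exact Complex.exp_ne_zero _
    · rw [dslope_of_ne _ hzu, slope_def_field]
      refine div_ne_zero (fun h => hzu ?_) (sub_ne_zero.2 hzu)
      obtain ⟨n, hn⟩ := Complex.exp_eq_exp_iff_exists_int.1 (sub_eq_zero.1 h)
      have him : z.im = n * (2 * Real.pi) := by simpa using congrArg Complex.im hn
      have hn0 : n = 0 := by
        have b1 : (n : ℝ) < 1 := by nlinarith [hz2.2]
        have b2 : (-1 : ℝ) < n := by nlinarith [hz2.1]
        have b1' : n < 1 := by exact_mod_cast b1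
        have b2' : -1 < n := by exact_mod_cast b2
        omega
      rw [hn, hn0]
      simp
  have hlc : ∀ s : ℝ, s ≠ 0 → Real.cos s = -1 → Real.sin s = 0 →
      Continuous fun x : ℝ => G (x + s * I) := by
    intro s h0 hs hs'
    have := hH.continuous
    have hd : ∀ y : ℝ, Real.exp y + Real.exp u ≠ 0 := fun y => by positivity
    simp_rw [fun x => hline x s h0 hs hs']
    fun_prop (disch := exact hd _)
  have hsub : ∀ x t : ℝ, |Real.exp x - Real.exp u| ≤ ‖cexp (x + t * I) - cexp u‖ := by
    intro x t
    have := abs_norm_sub_norm_le (cexp (x + t * I)) (cexp u)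
    rwa [hexp, ← ofReal_exp, norm_real, Real.norm_of_nonneg (Real.exp_nonneg u), ofReal_exp] at this
  have hDi : Integrable fun y : ℝ =>
      stripJump H y * ((Real.exp y / (Real.exp y + Real.exp u) : ℝ) : ℂ) := by
    refine ((integrable_exp_neg_mul_abs hκ).const_mul (2 * C)).mono'
      (Continuous.aestronglyMeasurable ?_) (.of_forall fun y => ?_)
    · have := hH.continuous
      have hd : ∀ y : ℝ, Real.exp y + Real.exp u ≠ 0 := fun y => by positivity
      unfold stripJump
      fun_prop (disch := exact hd _)
    · rw [norm_mul]
      refine (mul_le_of_le_one_right (norm_nonneg _) ?_).trans (norm_stripJump_le h1 h2 y)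
      rw [norm_real, Real.norm_of_nonneg (by positivity), div_le_one (by positivity)]
      linarith [Real.exp_pos u]
  have t1 : Tendsto (fun R : ℝ => (∫ x in (-R)..R, G (x + (-Real.pi : ℝ) * I))
      - ∫ x in (-R)..R, G (x + Real.pi * I)) atTop
      (𝓝 (∫ y : ℝ, stripJump H y * ((Real.exp y / (Real.exp y + Real.exp u) : ℝ) : ℂ))) := by
    refine (intervalIntegral_tendsto_integral hDi tendsto_neg_atTop_atBot tendsto_id).congr
      fun R => ?_
    rw [← intervalIntegral.integral_sub]
    · refine intervalIntegral.integral_congr fun y _ => ?_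
      rw [hline y _ (by linarith) (by simp) (by simp), hline y _ hπ.ne' (by simp) (by simp),
        stripJump]
      ring
    · exact (hlc _ (by linarith) (by simp) (by simp)).intervalIntegrable _ _
    · exact (hlc _ hπ.ne' (by simp) (by simp)).intervalIntegrable _ _
  have t2 : Tendsto (fun R : ℝ => ∫ y in (-Real.pi)..Real.pi, G (R + y * I)) atTop
      (𝓝 (-(2 * Real.pi) * H u)) := by
    have hb : Tendsto (fun R : ℝ => (C * Real.exp (-(κ * R)) + ‖H u‖ * Real.exp (u - R))
        / (1 - Real.exp (u - R)) * |Real.pi - -Real.pi|) atTop (𝓝 0) := by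
      have e1 : Tendsto (fun R : ℝ => Real.exp (-(κ * R))) atTop (𝓝 0) :=
        Real.tendsto_exp_neg_atTop_nhds_zero.comp (tendsto_id.const_mul_atTop hκ)
      have e2 : Tendsto (fun R : ℝ => Real.exp (u - R)) atTop (𝓝 0) :=
        Real.tendsto_exp_atBot.comp (tendsto_atBot_add_const_left _ u tendsto_neg_atTop_atBot)
      have := ((((e1.const_mul C).add (e2.const_mul ‖H u‖)).div (e2.const_sub 1)
        (by norm_num)).mul_const |Real.pi - -Real.pi|)
      simpa using this
    refine tendsto_iff_norm_sub_tendsto_zero.2 (squeeze_zero' (.of_forall fun _ => norm_nonneg _) ?_ hb)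
    filter_upwards [eventually_gt_atTop u, eventually_ge_atTop 0] with R hR hR0
    have hcont : IntervalIntegrable (fun y : ℝ => G (R + y * I)) volume (-Real.pi) Real.pi := by
      refine ((hGd R).continuousOn.comp (Continuous.continuousOn (by fun_prop)) ?_).intervalIntegrable
      intro y hy
      exact ⟨by simp [hR0], by simpa using hy⟩
    have e3 : (∫ y in (-Real.pi)..Real.pi, G (R + y * I)) - -(2 * Real.pi) * H u
        = ∫ y in (-Real.pi)..Real.pi, (G (R + y * I) + H u) := by
      rw [intervalIntegral.integral_add hcont intervalIntegrable_const,
        intervalIntegral.integral_const, real_smul]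
      push_cast
      ring
    rw [e3]
    refine intervalIntegral.norm_integral_le_of_norm_le_const fun y hy => ?_
    rw [uIoc_of_le (by linarith)] at hy
    have hne : (R + y * I : ℂ) ≠ u := fun h => hR.ne' (by simpa using congrArg Complex.re h)
    have hlt : 0 < Real.exp R - Real.exp u := sub_pos.2 (Real.exp_lt_exp.2 hR)
    have hs := hsub R y
    rw [abs_of_pos hlt] at hs
    have hne' : cexp (R + y * I) - cexp u ≠ 0 := norm_pos_iff.1 (hlt.trans_le hs)
    have e4 : G (R + y * I) + H u
        = (H (R + y * I) * cexp (R + y * I) - H u * cexp u) / (cexp (R + y * I) - cexp u) := by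
      rw [hGne _ hne]
      field_simp
      ring
    rw [e4, norm_div]
    have e5 : (C * Real.exp (-(κ * R)) + ‖H u‖ * Real.exp (u - R)) / (1 - Real.exp (u - R))
        = (C * Real.exp (-(κ * R)) * Real.exp R + ‖H u‖ * Real.exp u)
          / (Real.exp R - Real.exp u) := by
      rw [Real.exp_sub]
      have := Real.exp_pos R
      field_simp
    rw [e5]
    refine div_le_div₀ (by positivity) ?_ hlt hs
    refine (norm_sub_le _ _).trans ?_
    rw [norm_mul, norm_mul, hexp, ← ofReal_exp u, norm_real, Real.norm_of_nonneg (Real.exp_nonneg u)]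
    gcongr
    exact h1 R y (Ioc_subset_Icc_self hy)
  have t3 : Tendsto (fun R : ℝ => ∫ y in (-Real.pi)..Real.pi, G ((-R : ℝ) + y * I)) atTop
      (𝓝 0) := by
    have hb : Tendsto (fun R : ℝ => (‖h₀‖ + C + ‖H u‖) * Real.exp (-R)
        / (Real.exp u - Real.exp (-R)) * |Real.pi - -Real.pi|) atTop (𝓝 0) := by
      have e1 := Real.tendsto_exp_neg_atTop_nhds_zero
      have := ((e1.const_mul (‖h₀‖ + C + ‖H u‖)).div (e1.const_sub (Real.exp u))
        (by simp [Real.exp_ne_zero])).mul_const |Real.pi - -Real.pi|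
      simpa using this
    refine squeeze_zero_norm' ?_ hb
    filter_upwards [eventually_gt_atTop (-u), eventually_ge_atTop 0] with R hR hR0
    refine intervalIntegral.norm_integral_le_of_norm_le_const fun y hy => ?_
    have hRu : -R < u := by linarith
    have hne : ((-R : ℝ) + y * I : ℂ) ≠ u := fun h => hRu.ne (by simpa using congrArg Complex.re h)
    have hlt : 0 < Real.exp u - Real.exp (-R) := sub_pos.2 (Real.exp_lt_exp.2 hRu)
    have hs := hsub (-R) y
    rw [abs_sub_comm, abs_of_pos hlt] at hs
    rw [hGne _ hne, norm_div, norm_mul, hexp]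
    refine div_le_div₀ (by positivity) ?_ hlt hs
    refine mul_le_mul_of_nonneg_right ((norm_sub_le _ _).trans ?_) (Real.exp_nonneg _)
    have e6 := h2 (-R) y (by linarith)
    have e7 : C * Real.exp (κ * -R) ≤ C :=
      mul_le_of_le_one_right hC (Real.exp_le_one_iff.2 (by nlinarith))
    have e8 := norm_sub_norm_le (H ((-R : ℝ) + y * I)) h₀
    linarith
  have t4 := (t1.add (t2.const_mul I)).sub (t3.const_mul I)
  have t5 := tendsto_nhds_unique (t4.congr fun R =>
    rectangle_integral_eq_zero (hGd R)) tendsto_const_nhds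
  linear_combination t5

open Set Complex in
/-- Near the origin `E_{α,β}` is Lipschitz, by continuity of the difference quotient. -/
lemma norm_mittagLeffler_sub_le {α β : ℝ} (hα : 0 < α) (hβ : 0 < β) :
    ∃ C : ℝ, ∀ z : ℂ, ‖z‖ ≤ 1 → ‖mittagLeffler α β z - mittagLeffler α β 0‖ ≤ C * ‖z‖ := by
  have hd : Continuous (dslope (mittagLeffler α β) 0) := by
    rw [← continuousOn_univ]
    exact ((differentiableOn_dslope Filter.univ_mem).2
      (differentiable_mittagLeffler hα hβ).differentiableOn).continuousOn
  obtain ⟨C, hC⟩ := (isCompact_closedBall (0 : ℂ) 1).exists_bound_of_continuousOn hd.continuousOn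
  refine ⟨C, fun z hz => ?_⟩
  have := sub_smul_dslope (mittagLeffler α β) 0 z
  rw [← this, sub_zero, norm_smul, mul_comm]
  exact mul_le_mul_of_nonneg_right (hC z (by simpa using hz)) (norm_nonneg z)

/-! ### Schwartz functions `exp (-‖x‖^{4m})` -/

lemma abs_pow_mul_exp_neg_sq_le (n : ℕ) (x : ℝ) :
    |x| ^ n * Real.exp (-(x ^ 2 / 2)) ≤ Real.exp (n ^ 2 / 2) := by
  have h1 : |x| ^ n ≤ Real.exp (n * |x|) := by
    rw [Real.exp_nat_mul]
    gcongr
    linarith [Real.add_one_le_exp |x|]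
  calc |x| ^ n * Real.exp (-(x ^ 2 / 2)) ≤ Real.exp (n * |x|) * Real.exp (-(x ^ 2 / 2)) := by gcongr
    _ = Real.exp (n * |x| - x ^ 2 / 2) := by rw [← Real.exp_add, sub_eq_add_neg]
    _ ≤ Real.exp (n ^ 2 / 2) := by
        refine Real.exp_le_exp.2 ?_
        rw [← sq_abs x]
        nlinarith [sq_nonneg ((n : ℝ) - |x|)]

/-- The one-dimensional Gaussian `t ↦ exp (-t² / 2)` as a Schwartz function. -/
noncomputable def gaussianSchwartz : 𝓢(ℝ, ℝ) where
  toFun t := Real.exp (-(t ^ 2 / 2))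
  smooth' := by fun_prop
  decay' k n := by
    set p : Polynomial ℝ := (Polynomial.hermite n).map (algebraMap ℤ ℝ) with hp
    refine ⟨∑ i ∈ Finset.range (p.natDegree + 1), |p.coeff i| * Real.exp ((k + i : ℕ) ^ 2 / 2),
      fun x => ?_⟩
    rw [norm_iteratedFDeriv_eq_norm_iteratedDeriv, iteratedDeriv_eq_iterate,
      Polynomial.deriv_gaussian_eq_hermite_mul_gaussian, Polynomial.aeval_def,
      Polynomial.eval₂_eq_eval_map, ← hp, Polynomial.eval_eq_sum_range, norm_mul, norm_mul,
      norm_pow, norm_neg, norm_one, one_pow, one_mul, Real.norm_of_nonneg (Real.exp_nonneg _),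
      Real.norm_eq_abs]
    calc |x| ^ k * (‖∑ i ∈ Finset.range (p.natDegree + 1), p.coeff i * x ^ i‖
            * Real.exp (-(x ^ 2 / 2)))
        ≤ |x| ^ k * ((∑ i ∈ Finset.range (p.natDegree + 1), |p.coeff i| * |x| ^ i)
            * Real.exp (-(x ^ 2 / 2))) := by
          gcongr
          refine (norm_sum_le _ _).trans_eq (Finset.sum_congr rfl fun i _ => ?_)
          rw [Real.norm_eq_abs, abs_mul, abs_pow]
      _ = ∑ i ∈ Finset.range (p.natDegree + 1),
            |p.coeff i| * (|x| ^ (k + i) * Real.exp (-(x ^ 2 / 2))) := by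
          rw [Finset.sum_mul, Finset.mul_sum]
          refine Finset.sum_congr rfl fun i _ => ?_
          rw [pow_add]
          ring
      _ ≤ _ := by
          gcongr with i _
          exact abs_pow_mul_exp_neg_sq_le _ _

/-- The radial function `exp (-‖x‖^{4m})` is a Schwartz function: it is the Gaussian composed with
the polynomial `√2 ‖x‖^{2m}`. -/
lemma exists_schwartz_exp_neg_norm_pow {V : Type*} [NormedAddCommGroup V] [InnerProductSpace ℝ V]
    {m : ℕ} (hm : m ≠ 0) :
    ∃ φ : 𝓢(V, ℂ), ∀ x, φ x = (Real.exp (-‖x‖ ^ (4 * m)) : ℝ) := by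
  have hg : (fun x : V => √2 * (‖x‖ ^ 2) ^ m).HasTemperateGrowth :=
    (Function.HasTemperateGrowth.const _).mul ((Function.hasTemperateGrowth_norm_sq V).pow m)
  have hup : ∃ (k : ℕ) (C : ℝ), ∀ x : V, ‖x‖ ≤ C * (1 + ‖√2 * (‖x‖ ^ 2) ^ m‖) ^ k := by
    refine ⟨1, 1, fun x => ?_⟩
    rw [pow_one, one_mul, Real.norm_of_nonneg (by positivity), ← pow_mul]
    have h2 : 1 ≤ √2 := Real.one_le_sqrt.2 (by norm_num)
    have h3 : 0 ≤ ‖x‖ ^ (2 * m) := by positivity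
    rcases le_total ‖x‖ 1 with h | h
    · nlinarith
    · have := le_self_pow₀ h (show 2 * m ≠ 0 by omega)
      nlinarith
  refine ⟨(SchwartzMap.compCLM ℝ hg hup gaussianSchwartz).postcompCLM Complex.ofRealCLM,
    fun x => ?_⟩
  have e : (√2 * (‖x‖ ^ 2) ^ m) ^ 2 / 2 = ‖x‖ ^ (4 * m) := by
    rw [mul_pow, Real.sq_sqrt (by norm_num)]
    ring
  simp only [SchwartzMap.postcompCLM_apply, SchwartzMap.compCLM_apply, Function.comp_apply,
    Complex.ofRealCLM_apply]
  change ((Real.exp (-((√2 * (‖x‖ ^ 2) ^ m) ^ 2 / 2)) : ℝ) : ℂ) = _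
  rw [e]

/-! ### Superpositions of dilates and their Fourier transforms -/

/-- The Fourier transform of the superposition `x ↦ ∫ c(ω) φ(l(ω) x) dμ(ω)` of dilates of `φ`,
expressed through `F = 𝓕 φ`: the superposition of the rescaled functions
`l(ω)^{-n} F(l(ω)⁻¹ ξ)`, `n` being the dimension. -/
noncomputable def dilationSuperposition {V Ω : Type*} [NormedAddCommGroup V] [NormedSpace ℝ V]
    [MeasurableSpace Ω] (μ : Measure Ω) (c : Ω → ℂ) (l : Ω → ℝ) (F : V → ℂ) (ξ : V) : ℂ :=
  ∫ ω, c ω * ((((l ω) ^ Module.finrank ℝ V)⁻¹ : ℝ) * F ((l ω)⁻¹ • ξ)) ∂μ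

section

variable {V : Type*} [NormedAddCommGroup V] [InnerProductSpace ℝ V] [FiniteDimensional ℝ V]
  [MeasurableSpace V] [BorelSpace V] {Ω : Type*} [MeasurableSpace Ω] {μ : Measure Ω}

/-- Fourier transform of a dilate, tested against a Schwartz function. -/
lemma integral_fourier_mul_comp_smul (φ ψ : 𝓢(V, ℂ)) {r : ℝ} (hr : 0 < r) :
    ∫ x, 𝓕 ψ x * φ (r • x)
      = ∫ ξ, ψ ξ * (((r ^ Module.finrank ℝ V)⁻¹ : ℝ) * 𝓕 φ (r⁻¹ • ξ)) := by
  have hi : Integrable (fun x => φ (r • x)) (volume : Measure V) :=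
    φ.integrable.comp_smul hr.ne'
  have h1 : ∫ x, 𝓕 (ψ : V → ℂ) x • φ (r • x) = ∫ x, ψ x • 𝓕 (fun x => φ (r • x)) x := by
    simpa using! VectorFourier.integral_fourierIntegral_smul_eq_flip (L := innerₗ V)
      Real.continuous_fourierChar continuous_inner ψ.integrable hi
  simp only [smul_eq_mul] at h1
  rw [SchwartzMap.fourier_coe, h1]
  congr 1
  ext ξ
  congr 1
  rw [SchwartzMap.fourier_coe, Real.fourier_eq, Real.fourier_eq]
  have h2 := Measure.integral_comp_smul_of_nonneg (volume : Measure V)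
    (fun y : V => Real.fourierChar (-inner ℝ y (r⁻¹ • ξ)) • φ y) r (hR := hr.le)
  rw [Complex.real_smul] at h2
  rw [← h2]
  congr 1
  ext x
  rw [inner_smul_left, inner_smul_right, RCLike.conj_to_real, mul_inv_cancel_left₀ hr.ne']

open Function in
/-- The superposition of dilates has the expected Fourier transform in the sense of distributions:
Fubini's theorem, both double integrals being absolutely convergent since rescaling preserves
the supremum of `φ` and the integral of `𝓕 φ`. -/
lemma integral_fourier_mul_superposition [SFinite μ] (φ ψ : 𝓢(V, ℂ)) {c : Ω → ℂ} {l : Ω → ℝ}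
    (hc : Integrable c μ) (hl : Measurable l) (hl0 : ∀ᵐ ω ∂μ, 0 < l ω) :
    ∫ x, 𝓕 ψ x * ∫ ω, c ω * φ (l ω • x) ∂μ
      = ∫ ξ, ψ ξ * dilationSuperposition μ c l (𝓕 φ : 𝓢(V, ℂ)) ξ := by
  have hm1 : AEStronglyMeasurable (fun p : V × Ω => φ (l p.2 • p.1)) (volume.prod μ) :=
    (φ.continuous.measurable.comp ((hl.comp measurable_snd).smul measurable_fst)).aestronglyMeasurable
  have hm2 : AEStronglyMeasurable (fun p : V × Ω =>
      (((l p.2 ^ Module.finrank ℝ V)⁻¹ : ℝ) : ℂ) * 𝓕 φ ((l p.2)⁻¹ • p.1)) (volume.prod μ) := by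
    refine (Measurable.mul ?_ ?_).aestronglyMeasurable
    · exact Complex.measurable_ofReal.comp (((hl.comp measurable_snd).pow_const _).inv)
    · exact (𝓕 φ).continuous.measurable.comp ((hl.comp measurable_snd).inv.smul measurable_fst)
  obtain ⟨B, hB0, hB⟩ := φ.decay 0 0
  obtain ⟨A, hA0, hA⟩ := ψ.decay 0 0
  simp only [pow_zero, one_mul, norm_iteratedFDeriv_zero] at hB hA
  have i1 : Integrable (uncurry fun (x : V) (ω : Ω) => 𝓕 ψ x * (c ω * φ (l ω • x)))
      (volume.prod μ) := by
    refine (((𝓕 ψ).integrable (μ := volume)).mul_prod hc |>.norm.mul_const B).mono' ?_ ?_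
    · have := (((𝓕 ψ).integrable (μ := volume)).mul_prod hc).aestronglyMeasurable.mul hm1
      refine this.congr (.of_forall fun p => ?_)
      simp only [uncurry, Pi.mul_apply, mul_assoc]
    · refine .of_forall fun p => ?_
      simp only [uncurry]
      rw [← mul_assoc, norm_mul]
      gcongr
      exact hB _
  have i2 : Integrable (uncurry fun (x : V) (ω : Ω) => ψ x *
      (c ω * ((((l ω) ^ Module.finrank ℝ V)⁻¹ : ℝ) * 𝓕 φ ((l ω)⁻¹ • x)))) (volume.prod μ) := by
    have hm : AEStronglyMeasurable (uncurry fun (x : V) (ω : Ω) => ψ x *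
      (c ω * ((((l ω) ^ Module.finrank ℝ V)⁻¹ : ℝ) * 𝓕 φ ((l ω)⁻¹ • x)))) (volume.prod μ) :=
      ψ.continuous.aestronglyMeasurable.comp_fst.mul (hc.aestronglyMeasurable.comp_snd.mul hm2)
    have hb : ∀ᵐ ω ∂μ, Integrable (fun x : V => A * ‖c ω‖ *
        ‖(((l ω ^ Module.finrank ℝ V)⁻¹ : ℝ) : ℂ) * 𝓕 φ ((l ω)⁻¹ • x)‖) volume ∧
        ∫ x : V, A * ‖c ω‖ * ‖(((l ω ^ Module.finrank ℝ V)⁻¹ : ℝ) : ℂ) * 𝓕 φ ((l ω)⁻¹ • x)‖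
          = ‖c ω‖ * (A * ∫ x : V, ‖𝓕 φ x‖) := by
      filter_upwards [hl0] with ω hω
      have hr : 0 < (l ω)⁻¹ := inv_pos.2 hω
      refine ⟨((((𝓕 φ).integrable.comp_smul hr.ne').const_mul _).norm.const_mul _), ?_⟩
      simp_rw [norm_mul, integral_const_mul]
      rw [Measure.integral_comp_inv_smul_of_nonneg volume (fun x => ‖𝓕 φ x‖) hω.le,
        Complex.norm_real, Real.norm_of_nonneg (by positivity), smul_eq_mul,
        inv_mul_cancel_left₀ (by positivity)]
      ring
    have hle : ∀ ω : Ω, ∀ x : V, ‖ψ x * (c ω * ((((l ω) ^ Module.finrank ℝ V)⁻¹ : ℝ) *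
        𝓕 φ ((l ω)⁻¹ • x)))‖ ≤ A * ‖c ω‖ *
        ‖(((l ω ^ Module.finrank ℝ V)⁻¹ : ℝ) : ℂ) * 𝓕 φ ((l ω)⁻¹ • x)‖ := by
      intro ω x
      rw [norm_mul, norm_mul, mul_assoc]
      gcongr
      exact hA x
    refine (integrable_prod_iff' hm).2 ⟨?_, ?_⟩
    · filter_upwards [hb, hm.prodMk_right] with ω h1 h2
      exact h1.1.mono' h2 (.of_forall fun x => hle ω x)
    · refine (hc.norm.mul_const (A * ∫ x : V, ‖𝓕 φ x‖)).mono'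
        (hm.norm.prod_swap.integral_prod_right') ?_
      filter_upwards [hb] with ω h1
      rw [Real.norm_of_nonneg (integral_nonneg fun _ => norm_nonneg _), ← h1.2]
      exact integral_mono_of_nonneg (.of_forall fun _ => norm_nonneg _) h1.1
        (.of_forall fun x => hle ω x)
  simp_rw [dilationSuperposition, ← integral_const_mul]
  rw [integral_integral_swap i1, integral_integral_swap i2]
  refine integral_congr_ae ?_
  filter_upwards [hl0] with ω hω
  have := integral_fourier_mul_comp_smul φ ψ hω
  calc ∫ x, 𝓕 ψ x * (c ω * φ (l ω • x)) = c ω * ∫ x, 𝓕 ψ x * φ (l ω • x) := by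
        rw [← integral_const_mul]; congr 1; ext x; ring
    _ = _ := by
        rw [this, ← integral_const_mul]; congr 1; ext x; ring

lemma aestronglyMeasurable_dilationSuperposition [SFinite μ] (F : 𝓢(V, ℂ)) {c : Ω → ℂ} {l : Ω → ℝ}
    (hc : Integrable c μ) (hl : Measurable l) :
    AEStronglyMeasurable (dilationSuperposition μ c l F) (volume : Measure V) := by
  have hm2 : AEStronglyMeasurable (fun p : V × Ω => c p.2 *
      ((((l p.2 ^ Module.finrank ℝ V)⁻¹ : ℝ) : ℂ) * F ((l p.2)⁻¹ • p.1))) (volume.prod μ) := by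
    refine hc.aestronglyMeasurable.comp_snd.mul (Measurable.mul ?_ ?_).aestronglyMeasurable
    · exact Complex.measurable_ofReal.comp (((hl.comp measurable_snd).pow_const _).inv)
    · exact F.continuous.measurable.comp ((hl.comp measurable_snd).inv.smul measurable_fst)
  exact hm2.integral_prod_right'

end

lemma SchwartzMap.exists_norm_le_rpow_neg {V : Type*} [NormedAddCommGroup V] [NormedSpace ℝ V]
    (F : 𝓢(V, ℂ)) {b : ℝ} (hb : 0 ≤ b) :
    ∃ C : ℝ, 0 ≤ C ∧ ∀ x : V, x ≠ 0 → ‖F x‖ ≤ C * ‖x‖ ^ (-b) := by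
  obtain ⟨A, hA0, hA⟩ := F.decay 0 0
  obtain ⟨B, hB0, hB⟩ := F.decay ⌈b⌉₊ 0
  simp only [pow_zero, one_mul, norm_iteratedFDeriv_zero] at hA hB
  refine ⟨A + B, by positivity, fun x hx => ?_⟩
  have hx0 : 0 < ‖x‖ := norm_pos_iff.2 hx
  rw [Real.rpow_neg hx0.le, ← div_eq_mul_inv, le_div_iff₀ (by positivity)]
  rcases le_total ‖x‖ 1 with h | h
  · have := Real.rpow_le_one hx0.le h hb
    nlinarith [hA x, norm_nonneg (F x)]
  · have h1 : ‖x‖ ^ b ≤ ‖x‖ ^ ⌈b⌉₊ := by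
      rw [← Real.rpow_natCast]
      exact Real.rpow_le_rpow_of_exponent_le h (Nat.le_ceil b)
    nlinarith [hB x, norm_nonneg (F x), hA x]

/-- Pointwise bound for the Fourier transform of a superposition of dilates. -/
lemma norm_dilationSuperposition_le {V Ω : Type*} [NormedAddCommGroup V] [NormedSpace ℝ V]
    [MeasurableSpace Ω] {μ : Measure Ω} (F : 𝓢(V, ℂ)) {c : Ω → ℂ} {l : Ω → ℝ}
    (hl0 : ∀ᵐ ω ∂μ, 0 < l ω) {b : ℝ} (hb : 0 ≤ b)
    (hint : Integrable (fun ω => ‖c ω‖ * l ω ^ (b - Module.finrank ℝ V)) μ) :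
    ∃ C : ℝ, 0 ≤ C ∧ ∀ ξ : V, ξ ≠ 0 → ‖dilationSuperposition μ c l F ξ‖ ≤ C * ‖ξ‖ ^ (-b) := by
  obtain ⟨C, hC0, hC⟩ := F.exists_norm_le_rpow_neg hb
  refine ⟨C * ∫ ω, ‖c ω‖ * l ω ^ (b - Module.finrank ℝ V) ∂μ,
    mul_nonneg hC0 (integral_nonneg_of_ae ?_), fun ξ hξ => ?_⟩
  · filter_upwards [hl0] with ω hω
    simp only [Pi.zero_apply]
    positivity
  rw [mul_right_comm, ← integral_const_mul]
  refine norm_integral_le_of_norm_le (hint.const_mul _) ?_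
  filter_upwards [hl0] with ω hω
  have hne : (l ω)⁻¹ • ξ ≠ 0 := smul_ne_zero (inv_ne_zero hω.ne') hξ
  have h1 := hC _ hne
  rw [norm_smul, Real.norm_of_nonneg (inv_nonneg.2 hω.le),
    Real.mul_rpow (inv_nonneg.2 hω.le) (norm_nonneg _), Real.inv_rpow hω.le,
    Real.rpow_neg hω.le, inv_inv] at h1
  rw [norm_mul, norm_mul, Complex.norm_real, Real.norm_of_nonneg (by positivity),
    Real.rpow_sub hω, Real.rpow_natCast]
  calc ‖c ω‖ * ((l ω ^ Module.finrank ℝ V)⁻¹ * ‖F ((l ω)⁻¹ • ξ)‖)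
      ≤ ‖c ω‖ * ((l ω ^ Module.finrank ℝ V)⁻¹ * (C * (l ω ^ b * ‖ξ‖ ^ (-b)))) := by gcongr
    _ = _ := by ring

/-! ### Membership in `L^p` and the Stieltjes transform of `E_{α,β}` along a ray -/

open Set in
/-- A function that is `O(‖x‖^{-b₁})` and `O(‖x‖^{-b₂})` with `b₁ < n / p < b₂` is in `L^p`. -/
lemma memLp_of_norm_le_rpow {V : Type*} [NormedAddCommGroup V] [NormedSpace ℝ V] [Nontrivial V]
    [FiniteDimensional ℝ V] [MeasurableSpace V] [BorelSpace V] {μ : Measure V}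
    [μ.IsAddHaarMeasure] {g : V → ℂ} (hg : AEStronglyMeasurable g μ) {p b₁ b₂ C₁ C₂ : ℝ}
    (hp : 0 < p) (hb₁ : b₁ * p < Module.finrank ℝ V) (hb₂ : Module.finrank ℝ V < b₂ * p)
    (hC₁ : 0 ≤ C₁) (hC₂ : 0 ≤ C₂)
    (h₁ : ∀ x, x ≠ 0 → ‖g x‖ ≤ C₁ * ‖x‖ ^ (-b₁)) (h₂ : ∀ x, x ≠ 0 → ‖g x‖ ≤ C₂ * ‖x‖ ^ (-b₂)) :
    MemLp g (ENNReal.ofReal p) μ := by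
  have hn : 0 < Module.finrank ℝ V := Module.finrank_pos
  have hn1 : ((Module.finrank ℝ V - 1 : ℕ) : ℝ) = Module.finrank ℝ V - 1 := by
    rw [Nat.cast_sub hn, Nat.cast_one]
  set f : ℝ → ℝ := fun r => if r ≤ 1 then C₁ ^ p * r ^ (-(b₁ * p)) else C₂ ^ p * r ^ (-(b₂ * p))
    with hf
  have hfi : Integrable (fun x : V => f ‖x‖) μ := by
    refine (integrable_fun_norm_addHaar μ).2 ?_
    rw [← Ioc_union_Ioi_eq_Ioi (zero_le_one' ℝ), integrableOn_union]
    constructor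
    · have h := (intervalIntegral.intervalIntegrable_rpow' (a := 0) (b := 1)
        (r := Module.finrank ℝ V - 1 - b₁ * p) (by linarith)).1.const_mul (C₁ ^ p)
      refine IntegrableOn.congr_fun h (fun r hr => ?_) measurableSet_Ioc
      simp only [hf, if_pos hr.2, smul_eq_mul]
      rw [sub_eq_add_neg, Real.rpow_add hr.1, ← hn1, Real.rpow_natCast]
      ring
    · have h := (integrableOn_Ioi_rpow_of_lt (a := Module.finrank ℝ V - 1 - b₂ * p) (by linarith)
        one_pos).const_mul (C₂ ^ p)
      refine IntegrableOn.congr_fun h (fun r hr => ?_) measurableSet_Ioi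
      have hr0 : 0 < r := one_pos.trans hr
      simp only [hf, if_neg (not_le.2 (mem_Ioi.1 hr)), smul_eq_mul]
      rw [sub_eq_add_neg, Real.rpow_add hr0, ← hn1, Real.rpow_natCast]
      ring
  rw [← integrable_norm_rpow_iff hg (by simpa using hp) ENNReal.ofReal_ne_top,
    ENNReal.toReal_ofReal hp.le]
  refine hfi.mono' (hg.norm.aemeasurable.pow_const p).aestronglyMeasurable ?_
  have h0 : ∀ᵐ x ∂μ, x ≠ 0 := by simp [ae_iff]
  filter_upwards [h0] with x hx
  have hx0 : 0 < ‖x‖ := norm_pos_iff.2 hx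
  rw [Real.norm_of_nonneg (by positivity)]
  have aux : ∀ C b : ℝ, 0 ≤ C → ‖g x‖ ≤ C * ‖x‖ ^ (-b) → ‖g x‖ ^ p ≤ C ^ p * ‖x‖ ^ (-(b * p)) := by
    intro C b hC h
    refine (Real.rpow_le_rpow (norm_nonneg _) h hp.le).trans_eq ?_
    rw [Real.mul_rpow hC (by positivity), ← Real.rpow_mul hx0.le, neg_mul]
  simp only [hf]
  split_ifs
  · exact aux _ _ hC₁ (h₁ x hx)
  · exact aux _ _ hC₂ (h₂ x hx)

open Set Complex in
/-- Along a ray outside the sector `|arg z| ≤ πα/2` the Mittag-Leffler function is bounded, and for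
small `κ` the function `v ↦ E_{α,β}(e^{iφ} v^κ)` is a Stieltjes transform: raising to a small power
turns the slit plane into a narrow sector around the ray, where `E_{α,β}` decays. -/
lemma exists_stieltjes_mittagLeffler {α β φ : ℝ} (hα : 0 < α) (hα2 : α < 2) (hβ : 0 < β)
    (hφ : Real.pi * α / 2 < φ) (hφ' : φ < 2 * Real.pi - Real.pi * α / 2) :
    (∃ C : ℝ, ∀ r : ℝ, 0 ≤ r → ‖mittagLeffler α β (cexp (φ * I) * r)‖ ≤ C) ∧
    ∃ κ₀ > 0, ∀ κ : ℝ, 0 < κ → κ ≤ κ₀ → ∃ (D : ℝ → ℂ) (C : ℝ), Continuous D ∧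
      (∀ y, ‖D y‖ ≤ C * Real.exp (-(κ * |y|))) ∧
      ∀ v : ℝ, 0 < v → mittagLeffler α β (cexp (φ * I) * (v ^ κ : ℝ))
        = ∫ y : ℝ, D y * ((Real.exp y / (Real.exp y + v) : ℝ) : ℂ) := by
  have hπ := Real.pi_pos
  obtain ⟨ρ, hρ0, hρ1, hρ2⟩ : ∃ ρ : ℝ, 0 < ρ ∧ ρ ≤ φ - Real.pi * α / 2 ∧
      ρ ≤ 2 * Real.pi - Real.pi * α / 2 - φ :=
    ⟨min (φ - Real.pi * α / 2) (2 * Real.pi - Real.pi * α / 2 - φ),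
      lt_min (by linarith) (by linarith), min_le_left _ _, min_le_right _ _⟩
  have hρπ : ρ < Real.pi := by nlinarith
  have hb := norm_mittagLeffler_le (ψ := Real.pi / 2 + ρ / 8) (ε := ρ / 4) hα hβ
    (by linarith) (by linarith) (by linarith) (by linarith)
  obtain ⟨C₁, hC₁⟩ := hb
  have hC₁' : ∀ r θ : ℝ, 0 < r → |θ - φ| ≤ ρ / 4 →
      ‖mittagLeffler α β (r * cexp (θ * I))‖ ≤ C₁ / r := by
    intro r θ hr hθ
    rw [abs_le] at hθ
    refine hC₁ r θ hr ?_ ?_ <;> nlinarith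
  obtain ⟨C₂, hC₂⟩ := norm_mittagLeffler_sub_le hα hβ
  have hC1 : 0 ≤ C₁ := by
    simpa using (norm_nonneg _).trans (hC₁' 1 φ one_pos (by simp; positivity))
  have hC2 : 0 ≤ C₂ := by
    simpa using (norm_nonneg _).trans (hC₂ 1 (by simp))
  refine ⟨⟨C₁ + C₂ + ‖mittagLeffler α β 0‖, fun r hr => ?_⟩, ρ / (4 * Real.pi), by positivity,
    fun κ hκ hκ' => ?_⟩
  · rcases le_total r 1 with h | h
    · have hz : ‖cexp (φ * I) * r‖ = r := by
        rw [norm_mul, norm_exp_ofReal_mul_I, norm_real, Real.norm_of_nonneg hr, one_mul]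
      have h1 := hC₂ (cexp (φ * I) * r) (by rwa [hz])
      rw [hz] at h1
      have h2 := norm_sub_norm_le (mittagLeffler α β (cexp (φ * I) * r)) (mittagLeffler α β 0)
      nlinarith
    · have h1 := hC₁' r φ (by linarith) (by simp; positivity)
      have h2 : C₁ / r ≤ C₁ := div_le_self hC1 h
      rw [mul_comm]
      linarith [norm_nonneg (mittagLeffler α β 0)]
  rw [le_div_iff₀ (by positivity)] at hκ'
  set H : ℂ → ℂ := fun u => mittagLeffler α β (cexp (φ * I + κ * u)) with hHdef
  have hH : Differentiable ℂ H := (differentiable_mittagLeffler hα hβ).comp (by fun_prop)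
  have hz : ∀ x t : ℝ, cexp (φ * I + κ * (x + t * I))
      = (Real.exp (κ * x) : ℝ) * cexp ((φ + κ * t : ℝ) * I) := by
    intro x t
    rw [ofReal_exp, ← Complex.exp_add]
    push_cast
    ring_nf
  have h1 : ∀ x t : ℝ, t ∈ Icc (-Real.pi) Real.pi →
      ‖H (x + t * I)‖ ≤ (C₁ + C₂) * Real.exp (-(κ * x)) := by
    intro x t ht
    simp only [hHdef, hz]
    refine (hC₁' _ _ (Real.exp_pos _) ?_).trans ?_
    · rw [add_sub_cancel_left, abs_mul, abs_of_pos hκ]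
      have := abs_le.2 ht
      nlinarith
    · rw [Real.exp_neg, ← div_eq_mul_inv]
      gcongr
      linarith
  have h2 : ∀ x t : ℝ, x ≤ 0 →
      ‖H (x + t * I) - mittagLeffler α β 0‖ ≤ (C₁ + C₂) * Real.exp (κ * x) := by
    intro x t hx
    have hn : ‖((Real.exp (κ * x) : ℝ) : ℂ) * cexp ((φ + κ * t : ℝ) * I)‖ = Real.exp (κ * x) := by
      rw [norm_mul, norm_exp_ofReal_mul_I, norm_real, Real.norm_of_nonneg (Real.exp_nonneg _),
        mul_one]
    simp only [hHdef, hz]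
    refine (hC₂ _ ?_).trans ?_
    · rw [hn, Real.exp_le_one_iff]
      nlinarith
    · rw [hn]
      gcongr
      linarith
  have hpi : (2 * Real.pi * I : ℂ) ≠ 0 := by simp [hπ.ne']
  refine ⟨fun y => stripJump H y / (2 * Real.pi * I), 2 * (C₁ + C₂), ?_, fun y => ?_, fun v hv => ?_⟩
  · have := hH.continuous
    unfold stripJump
    fun_prop (disch := assumption)
  · have hpi1 : 1 ≤ ‖(2 * Real.pi * I : ℂ)‖ := by
      rw [norm_mul, norm_mul, norm_I, norm_real, Real.norm_of_nonneg hπ.le]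
      simp only [Complex.norm_ofNat, mul_one]
      linarith [Real.pi_gt_three]
    rw [norm_div]
    exact (div_le_self (norm_nonneg _) hpi1).trans (norm_stripJump_le h1 h2 y)
  · have key := integral_stripJump hκ hH h1 h2 (Real.log v)
    rw [Real.exp_log hv] at key
    simp_rw [div_mul_eq_mul_div]
    rw [integral_div, key, mul_div_cancel_left₀ _ hpi]
    simp only [hHdef]
    rw [Complex.exp_add, Real.rpow_def_of_pos hv]
    push_cast
    rw [mul_comm (κ : ℂ)]

/-! ### The Fourier transform of the radial Mittag-Leffler function -/

open Set in
/-- The Stieltjes kernel as a Laplace integral. -/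
lemma integral_exp_neg_mul_exp_neg {y v : ℝ} (hv : 0 < v) :
    ∫ σ in Ioi (0 : ℝ), Real.exp (-σ) * Real.exp (-(σ * Real.exp (-y) * v))
      = Real.exp y / (Real.exp y + v) := by
  have h := integral_exp_mul_Ioi (a := -(1 + Real.exp (-y) * v)) (by
    have : 0 < Real.exp (-y) * v := by positivity
    linarith) 0
  have e : ∀ σ : ℝ, Real.exp (-σ) * Real.exp (-(σ * Real.exp (-y) * v))
      = Real.exp (-(1 + Real.exp (-y) * v) * σ) := fun σ => by
    rw [← Real.exp_add]; ring_nf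
  simp_rw [e, h]
  rw [mul_zero, Real.exp_zero, Real.exp_neg]
  have := Real.exp_pos y
  field_simp

open Set Complex in
/-- The Fourier transform of `x ↦ E_{α,β}(e^{iφ} ‖x‖^γ)` is a function `g` which is `O(‖ξ‖^{-b})` for
all `b ≥ 0` within distance `γ` of the dimension. -/
theorem exists_fourier_mittagLeffler_norm {V : Type*} [NormedAddCommGroup V]
    [InnerProductSpace ℝ V] [FiniteDimensional ℝ V] [Nontrivial V] [MeasurableSpace V]
    [BorelSpace V] {α β γ φ : ℝ} (hα : 0 < α) (hα2 : α < 2) (hβ : 0 < β) (hγ : 0 < γ)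
    (hφ : Real.pi * α / 2 < φ) (hφ' : φ < 2 * Real.pi - Real.pi * α / 2) :
    ∃ g : V → ℂ, AEStronglyMeasurable g volume ∧
      (∀ ψ : 𝓢(V, ℂ), ∫ x, 𝓕 ψ x * mittagLeffler α β (cexp (φ * I) * (‖x‖ ^ γ : ℝ))
        = ∫ ξ, ψ ξ * g ξ) ∧
      ∀ b : ℝ, 0 ≤ b → |b - Module.finrank ℝ V| < γ →
        ∃ C : ℝ, 0 ≤ C ∧ ∀ ξ : V, ξ ≠ 0 → ‖g ξ‖ ≤ C * ‖ξ‖ ^ (-b) := by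
  obtain ⟨-, κ₀, hκ₀, hκ⟩ := exists_stieltjes_mittagLeffler hα hα2 hβ hφ hφ'
  -- the exponent `4 m` is large enough for `γ / (4 m) ≤ κ₀` and exceeds the dimension
  obtain ⟨m, hm⟩ := exists_nat_gt (max (γ / κ₀) (Module.finrank ℝ V))
  have hm1 : γ / κ₀ < m := (le_max_left _ _).trans_lt hm
  have hm2 : (Module.finrank ℝ V : ℝ) < m := (le_max_right _ _).trans_lt hm
  have hm0 : (0 : ℝ) < m := (Nat.cast_nonneg _).trans_lt hm2
  have hm0' : m ≠ 0 := by rintro rfl; simp at hm0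
  set N : ℝ := ((4 * m : ℕ) : ℝ) with hN
  have hNm : N = 4 * m := by rw [hN]; push_cast; ring
  have hN0 : 0 < N := by rw [hNm]; positivity
  have hκγ : γ / N ≤ κ₀ := by
    rw [div_le_iff₀ hN0, hNm]
    rw [div_lt_iff₀ hκ₀] at hm1
    nlinarith
  obtain ⟨D, C, hDc, hD, hrep⟩ := hκ (γ / N) (by positivity) hκγ
  obtain ⟨f, hf⟩ := exists_schwartz_exp_neg_norm_pow (V := V) hm0'
  set μ : Measure (ℝ × ℝ) := volume.prod (volume.restrict (Ioi 0)) with hμ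
  set c : ℝ × ℝ → ℂ := fun p => D p.1 * (Real.exp (-p.2) : ℝ) with hc
  set l : ℝ × ℝ → ℝ := fun p => (p.2 * Real.exp (-p.1)) ^ N⁻¹ with hl
  have hpos : ∀ᵐ p ∂μ, 0 < p.2 := by
    have : ∀ᵐ t ∂(volume.restrict (Ioi (0 : ℝ))), 0 < t := ae_restrict_mem measurableSet_Ioi
    exact Measure.quasiMeasurePreserving_snd.ae this
  have hl0 : ∀ᵐ p ∂μ, 0 < l p := by
    filter_upwards [hpos] with p hp
    simp only [hl]
    positivity
  have hlm : Measurable l := by fun_prop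
  have hint : ∀ b : ℝ, 0 ≤ b → |b - Module.finrank ℝ V| < γ →
      Integrable (fun p => ‖c p‖ * l p ^ (b - Module.finrank ℝ V)) μ := by
    intro b hb hbγ
    set a : ℝ := (b - Module.finrank ℝ V) / N with ha
    have ha1 : |a| < γ / N := by
      rw [ha, abs_div, abs_of_pos hN0]
      gcongr
    have ha2 : 0 < 1 + a := by
      rw [ha, ← sub_lt_iff_lt_add', lt_div_iff₀ hN0]
      linarith
    have i1 : Integrable (fun y : ℝ => ‖D y‖ * Real.exp (-(a * y))) := by
      refine ((integrable_exp_neg_mul_abs (sub_pos.2 ha1)).const_mul C).mono' (by fun_prop)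
        (.of_forall fun y => ?_)
      rw [Real.norm_of_nonneg (by positivity)]
      refine (mul_le_mul_of_nonneg_right (hD y) (Real.exp_nonneg _)).trans ?_
      have hC0 : 0 ≤ C := by simpa using (norm_nonneg _).trans (hD 0)
      rw [mul_assoc, ← Real.exp_add]
      refine mul_le_mul_of_nonneg_left (Real.exp_le_exp.2 ?_) hC0
      have : -(a * y) ≤ |a| * |y| := by rw [← abs_mul]; exact neg_le_abs _
      linarith
    have i2 := Real.GammaIntegral_convergent ha2
    refine (i1.mul_prod i2).congr ?_
    filter_upwards [hpos] with p hp
    simp only [hc, hl]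
    rw [norm_mul, norm_real, Real.norm_of_nonneg (Real.exp_nonneg _), ← Real.rpow_mul (by positivity),
      Real.mul_rpow hp.le (Real.exp_nonneg _), ← Real.exp_mul, add_sub_cancel_left,
      inv_mul_eq_div, ← ha]
    ring_nf
  have hci : Integrable c μ := by
    have h := hint (Module.finrank ℝ V) (Nat.cast_nonneg _) (by simpa using hγ)
    simp only [sub_self, Real.rpow_zero, mul_one] at h
    exact (integrable_norm_iff (by fun_prop)).1 h
  refine ⟨dilationSuperposition μ c l (𝓕 f : 𝓢(V, ℂ)),
    aestronglyMeasurable_dilationSuperposition _ hci hlm, fun ψ => ?_, fun b hb hbγ =>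
    norm_dilationSuperposition_le _ hl0 hb (hint b hb hbγ)⟩
  rw [← integral_fourier_mul_superposition f ψ hci hlm hl0]
  have hne : ∀ᵐ x ∂(volume : Measure V), x ≠ 0 := by simp [ae_iff]
  refine integral_congr_ae ?_
  filter_upwards [hne] with x hx
  have hx0 : 0 < ‖x‖ := norm_pos_iff.2 hx
  have hv : 0 < ‖x‖ ^ N := by positivity
  have hvκ : (‖x‖ ^ N) ^ (γ / N) = ‖x‖ ^ γ := by
    rw [← Real.rpow_mul hx0.le, mul_div_cancel₀ _ hN0.ne']
  congr 1
  rw [← hvκ, hrep _ hv]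
  have hfl : ∀ᵐ p ∂μ, c p * f (l p • x)
      = D p.1 * ((Real.exp (-p.2) * Real.exp (-(p.2 * Real.exp (-p.1) * ‖x‖ ^ N)) : ℝ) : ℂ) := by
    filter_upwards [hpos] with p hp
    have hlp : (l p * ‖x‖) ^ (4 * m) = p.2 * Real.exp (-p.1) * ‖x‖ ^ N := by
      have hlp0 : 0 ≤ p.2 * Real.exp (-p.1) := by positivity
      rw [← Real.rpow_natCast, ← hN, Real.mul_rpow (Real.rpow_nonneg hlp0 _) hx0.le,
        ← Real.rpow_mul hlp0, inv_mul_cancel₀ hN0.ne', Real.rpow_one]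
    have hl0' : 0 ≤ l p := by simp only [hl]; positivity
    rw [hf, norm_smul, Real.norm_of_nonneg hl0', hlp, ofReal_mul, ← mul_assoc]
  rw [integral_congr_ae hfl, integral_prod]
  · refine integral_congr_ae (.of_forall fun y => ?_)
    simp only
    rw [integral_const_mul, integral_complex_ofReal, integral_exp_neg_mul_exp_neg hv]
  · refine Integrable.congr ?_ hfl
    obtain ⟨B, hB0, hB⟩ := f.decay 0 0
    simp only [pow_zero, one_mul, norm_iteratedFDeriv_zero] at hB
    refine (hci.norm.mul_const B).mono' ?_ (.of_forall fun p => ?_)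
    · exact hci.aestronglyMeasurable.mul
        (f.continuous.measurable.comp (hlm.smul_const x)).aestronglyMeasurable
    · rw [norm_mul]
      gcongr
      exact hB _

open Set Complex in
/-- The Fourier transform of the radial Mittag-Leffler function is in `L^p` as soon as
`d (1 - 1/p) < γ`. -/
theorem fourierTransformMemLp_mittagLefflerRadial {d : ℕ} (hd : 1 ≤ d) {α β γ s : ℝ}
    (hα : 0 < α) (hα2 : α < 2) (hβ : 0 < β) (hγ : 0 < γ) (hs : α / 2 < |s|) (hs1 : |s| ≤ 1)
    {p : ℝ≥0∞} (hp : 1 < p) (hpγ : (d : ℝ) * (1 - p.toReal⁻¹) < γ) :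
    FourierTransformMemLp (mittagLefflerRadial d α β s γ) p := by
  have hπ := Real.pi_pos
  -- for negative `s` the argument `π s` is replaced by `π s + 2 π`
  obtain ⟨φ, hφ, hφ', hexp⟩ : ∃ φ : ℝ, Real.pi * α / 2 < φ ∧ φ < 2 * Real.pi - Real.pi * α / 2 ∧
      cexp (I * Real.pi * s) = cexp (φ * I) := by
    rcases le_total 0 s with h | h
    · rw [abs_of_nonneg h] at hs hs1
      refine ⟨Real.pi * s, by nlinarith, by nlinarith, ?_⟩
      push_cast
      ring_nf
    · rw [abs_of_nonpos h] at hs hs1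
      refine ⟨Real.pi * s + 2 * Real.pi, by nlinarith, by nlinarith, ?_⟩
      push_cast
      rw [add_mul, Complex.exp_add, Complex.exp_two_pi_mul_I, mul_one]
      ring_nf
  have : Nonempty (Fin d) := ⟨⟨0, hd⟩⟩
  obtain ⟨g, hgm, hg, hgb⟩ := exists_fourier_mittagLeffler_norm
    (V := EuclideanSpace ℝ (Fin d)) hα hα2 hβ hγ hφ hφ'
  obtain ⟨⟨B, hB⟩, -⟩ := exists_stieltjes_mittagLeffler hα hα2 hβ hφ hφ'
  have hfr : Module.finrank ℝ (EuclideanSpace ℝ (Fin d)) = d := by simp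
  rw [hfr] at hgb
  have hd0 : (0 : ℝ) < d := by exact_mod_cast hd
  have hmem : MemLp (mittagLefflerRadial d α β s γ) ∞ volume := by
    refine memLp_top_of_bound (Continuous.aestronglyMeasurable ?_) B (.of_forall fun x => ?_)
    · have h1 := (differentiable_mittagLeffler hα hβ).continuous
      have h2 : Continuous fun x : EuclideanSpace ℝ (Fin d) => ‖x‖ ^ γ :=
        continuous_norm.rpow_const fun _ => Or.inr hγ.le
      unfold mittagLefflerRadial
      fun_prop
    · rw [mittagLefflerRadial, hexp]
      exact hB _ (by positivity)
  have hgp : MemLp g p volume := by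
    have hne : ∀ᵐ x ∂(volume : Measure (EuclideanSpace ℝ (Fin d))), x ≠ 0 := by simp [ae_iff]
    rcases eq_or_ne p ∞ with rfl | hpt
    · obtain ⟨C, -, hC⟩ := hgb 0 le_rfl (by
        rw [zero_sub, abs_neg, Nat.abs_cast]
        simpa using hpγ)
      refine memLp_top_of_bound hgm C ?_
      filter_upwards [hne] with x hx
      simpa using hC x hx
    · set q := p.toReal with hq
      have hq1 : 1 < q := by
        rw [hq, ← ENNReal.toReal_one]
        exact (ENNReal.toReal_lt_toReal ENNReal.one_ne_top hpt).2 hp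
      have hq0 : 0 < q := by linarith
      -- exponents on either side of `d / q`, at a distance that keeps them admissible
      obtain ⟨η, hη0, hη1, hη2⟩ : ∃ η : ℝ, 0 < η ∧ η < d * q⁻¹ ∧ η < γ - d * (1 - q⁻¹) := by
        obtain ⟨η, h0, h1⟩ := exists_between
          (show 0 < min (d * q⁻¹) (γ - d * (1 - q⁻¹)) from lt_min (by positivity) (by linarith))
        exact ⟨η, h0, h1.trans_le (min_le_left _ _), h1.trans_le (min_le_right _ _)⟩
      have hq2 : q⁻¹ < 1 := inv_lt_one_of_one_lt₀ hq1
      have hdq : (d : ℝ) * q⁻¹ * q = d := by field_simp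
      have hdq' : 0 < (d : ℝ) * (1 - q⁻¹) := mul_pos hd0 (by linarith)
      obtain ⟨C₁, hC₁, h₁⟩ := hgb (d * q⁻¹ - η) (by linarith) (by rw [abs_lt]; constructor <;> nlinarith)
      obtain ⟨C₂, hC₂, h₂⟩ := hgb (d * q⁻¹ + η) (by positivity)
        (by rw [abs_lt]; constructor <;> nlinarith)
      have := memLp_of_norm_le_rpow (μ := volume) hgm hq0 (by rw [hfr]; nlinarith)
        (by rw [hfr]; nlinarith) hC₁ hC₂ h₁ h₂
      rwa [hq, ENNReal.ofReal_toReal hpt] at this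
  refine ⟨hmem, ⟨hp.le⟩, hgp.toLp g, ?_⟩
  have : Fact (1 ≤ p) := ⟨hp.le⟩
  ext ψ
  rw [TemperedDistribution.fourier_apply, Lp.toTemperedDistribution_apply,
    Lp.toTemperedDistribution_apply]
  have e1 : ∫ x, (𝓕 ψ) x • (hmem.toLp (mittagLefflerRadial d α β s γ)) x
      = ∫ x, 𝓕 ψ x * mittagLeffler α β (cexp (φ * I) * (‖x‖ ^ γ : ℝ)) := by
    refine integral_congr_ae ?_
    filter_upwards [hmem.coeFn_toLp] with x hx
    rw [hx, smul_eq_mul, mittagLefflerRadial, hexp]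
  have e2 : ∫ x, ψ x • (hgp.toLp g) x = ∫ x, ψ x * g x := by
    refine integral_congr_ae ?_
    filter_upwards [hgp.coeFn_toLp] with x hx
    rw [hx, smul_eq_mul]
  rw [e1, e2, hg]

theorem theorem3 (d : ℕ) (hd : 1 ≤ d) (α β γ s : ℝ) (hα0 : 0 < α) (hα2 : α < 2)
    (hβ : 0 < β) (hγ : 0 < γ) (hs : α / 2 < |s|) (hs1 : |s| ≤ 1) :
    (∀ p p' : ℝ≥0∞, p.HolderConjugate p' → 1 < p → (d : ℝ≥0∞) < ENNReal.ofReal γ * p' →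
      FourierTransformMemLp (mittagLefflerRadial d α β s γ) p) ∧
    ((d : ℝ) < γ → ∀ p : ℝ≥0∞, 1 < p → p ≤ ∞ →
      FourierTransformMemLp (mittagLefflerRadial d α β s γ) p) ∧
    (γ = (d : ℝ) → ∀ p : ℝ≥0∞, 1 < p → p < ∞ →
      FourierTransformMemLp (mittagLefflerRadial d α β s γ) p) ∧
    (γ < (d : ℝ) → ∀ p : ℝ≥0∞, 1 < p → p < ENNReal.ofReal ((d : ℝ) / ((d : ℝ) - γ)) →
      FourierTransformMemLp (mittagLefflerRadial d α β s γ) p) := by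
  have hd0 : (0 : ℝ) < d := by exact_mod_cast hd
  have main : ∀ p : ℝ≥0∞, 1 < p → (d : ℝ) * (1 - p.toReal⁻¹) < γ →
      FourierTransformMemLp (mittagLefflerRadial d α β s γ) p := fun p hp h =>
    fourierTransformMemLp_mittagLefflerRadial hd hα0 hα2 hβ hγ hs hs1 hp h
  have hp0 : ∀ p : ℝ≥0∞, 1 < p → p < ∞ → 0 < p.toReal := fun p hp hpt =>
    ENNReal.toReal_pos (by rintro rfl; simp at hp) hpt.ne
  refine ⟨fun p p' hpp hp h => main p hp ?_, fun h p hp _ => main p hp ?_,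
    fun h p hp hpt => main p hp ?_, fun h p hp hpd => main p hp ?_⟩
  · have hsum := hpp.inv_add_inv_eq_one
    have hp'0 : p' ≠ 0 := by
      rintro rfl
      simp at hsum
    have hp't : p' ≠ ∞ := by
      rintro rfl
      rw [ENNReal.inv_top, add_zero, ENNReal.inv_eq_one] at hsum
      exact hp.ne' hsum
    have hinv := congrArg ENNReal.toReal hsum
    rw [ENNReal.toReal_add (by simpa using (one_pos.trans hp).ne') (by simpa using hp'0),
      ENNReal.toReal_inv, ENNReal.toReal_inv, ENNReal.toReal_one] at hinv
    have h1 := (ENNReal.toReal_lt_toReal (ENNReal.natCast_ne_top d)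
      (ENNReal.mul_ne_top ENNReal.ofReal_ne_top hp't)).2 h
    rw [ENNReal.toReal_natCast, ENNReal.toReal_mul, ENNReal.toReal_ofReal hγ.le] at h1
    rw [← hinv, add_sub_cancel_left, ← div_eq_mul_inv, div_lt_iff₀ (ENNReal.toReal_pos hp'0 hp't)]
    exact h1
  · have : 0 ≤ p.toReal⁻¹ := inv_nonneg.2 ENNReal.toReal_nonneg
    nlinarith
  · have : 0 < p.toReal⁻¹ := inv_pos.2 (hp0 p hp hpt)
    nlinarith
  · have hpt : p < ∞ := hpd.trans ENNReal.ofReal_lt_top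
    have hq := hp0 p hp hpt
    have h1 : p.toReal < d / (d - γ) :=
      (ENNReal.lt_ofReal_iff_toReal_lt hpt.ne).1 hpd
    rw [lt_div_iff₀ (by linarith)] at h1
    rw [mul_sub, mul_one, sub_lt_comm, ← div_eq_mul_inv, lt_div_iff₀ hq]
    linarith
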